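/- For a set $F$ of edges, regard $F$ as the graph whose vertices are the endpoints of the edges in $F$; its diameter is measured inside this graph (it is infinite if the graph is disconnected, and $0$ if $F=\emptyset$). For an integer $n\ge 1$, a real $\varepsilon\ge 0$ and an integer $d\ge 1$, let $P(n,\varepsilon,d)$ be the smallest $\ell\ge 0$ such that every graph $G=(V,E)$ on $n$ vertices has an edge partition $E=E_0\cup E_1\cup\dots\cup E_\ell$ (parts may be empty) with $|E_0|\le \varepsilon n^2$ and with the diameter of $E_i$ at most $d$ for $1\le i\le \ell$. (a) For every $\delta>0$ there is a constant $c=c(\delta)>0$ such that for all $n\ge 2$ and all $0\le\varepsilon\le \frac14-\delta$, $$c\,n\le P(n,\varepsilon,2)\le n .$$ (b) There is an absolute constant $c>0$ such that for all $n\ge 1$ and all $\varepsilon\ge n^{-1/2}$ we have $P(n,\varepsilon,3)\le 50\,\varepsilon^{-2}$, and moreover $P(n,\varepsilon,3)\ge c\,\varepsilon^{-2}$ whenever $\varepsilon n^2<\binom n2$. (c) There is an absolute constant $c>0$ such that for all $n\ge 1$ and all $\varepsilon\ge n^{-1}$ we have $P(n,\varepsilon,4)\le 16\,\varepsilon^{-1}$,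 and moreover $P(n,\varepsilon,4)\ge c\,\varepsilon^{-1}$ whenever $\varepsilon n^2<\binom n2$. (If $\varepsilon n^2\ge\binom n2$, then trivially $P(n,\varepsilon,d)=0$.) -/

import Mathlib

/-- The graph formed by a set `F` of edges, i.e. its vertices are the endpoints of the edges
in `F`, so that isolated vertices of the ambient vertex set are ignored. -/
def edgeGraph {V : Type*} (F : Set (Sym2 V)) :
    SimpleGraph (SimpleGraph.fromEdgeSet F).support :=
  (SimpleGraph.fromEdgeSet F).induce (SimpleGraph.fromEdgeSet F).support

/-- `E 0, E 1, …, E ℓ` is an edge partition of `G` (empty parts are allowed) such that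
`|E 0| ≤ ε n ^ 2` and `E 1, …, E ℓ` have diameter at most `d`. Distances in `E i` are measured
inside `E i`; the diameter is `⊤` if `E i` is disconnected. -/
structure IsLowDiamPartition {n : ℕ} (G : SimpleGraph (Fin n)) (ε : ℝ) (d ℓ : ℕ)
    (E : Fin (ℓ + 1) → Set (Sym2 (Fin n))) : Prop where
  iUnion_eq : ⋃ i, E i = G.edgeSet
  disjoint : ∀ i j, i ≠ j → Disjoint (E i) (E j)
  exceptional : ((E 0).ncard : ℝ) ≤ ε * (n : ℝ) ^ 2
  diam_le : ∀ i, i ≠ 0 → (edgeGraph (E i)).ediam ≤ (d : ℕ∞)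

/-- The numbers `ℓ` such that every graph on `n` vertices has a partition as above. -/
def admissibleSizes (n : ℕ) (ε : ℝ) (d : ℕ) : Set ℕ :=
  {ℓ | ∀ G : SimpleGraph (Fin n), ∃ E : Fin (ℓ + 1) → Set (Sym2 (Fin n)),
    IsLowDiamPartition G ε d ℓ E}

/-- `P(n, ε, d)`: the smallest admissible `ℓ`. -/
noncomputable def lowDiamNumber (n : ℕ) (ε : ℝ) (d : ℕ) : ℕ :=
  sInf (admissibleSizes n ε d)

/-- For `ε ≥ 0` and `d ≥ 1` there is an admissible `ℓ` (every edge may be a part of its own), so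
the minimum in the definition of `P(n, ε, d)` is attained. -/
theorem lowDiamNumber_isLeast (n : ℕ) (ε : ℝ) (d : ℕ) (hε : 0 ≤ ε) (hd : 1 ≤ d) :
    IsLeast (admissibleSizes n ε d) (lowDiamNumber n ε d) := by
  have key : (admissibleSizes n ε d).Nonempty := by
    classical
    let f := Fintype.equivFin (Sym2 (Fin n))
    refine ⟨Fintype.card (Sym2 (Fin n)), fun G => ?_⟩
    refine ⟨fun i => {e | e ∈ G.edgeSet ∧ (f e).succ = i}, ?_, ?_, ?_, ?_⟩
    · ext e
      simp
    · intro i j hij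
      rw [Set.disjoint_left]
      rintro e ⟨_, h1⟩ ⟨_, h2⟩
      exact hij (h1.symm.trans h2)
    · have : {e | e ∈ G.edgeSet ∧ (f e).succ = 0} = (∅ : Set (Sym2 (Fin n))) := by
        ext e
        simp [Fin.succ_ne_zero]
      simp only [this, Set.ncard_empty, Nat.cast_zero]
      positivity
    · intro i _
      apply SimpleGraph.ediam_le_of_edist_le
      rintro ⟨u, hu0⟩ ⟨v, hv0⟩
      obtain ⟨u', hu⟩ := (SimpleGraph.mem_support _).mp hu0
      obtain ⟨v', hv⟩ := (SimpleGraph.mem_support _).mp hv0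
      refine le_trans ?_ (Nat.one_le_cast.mpr hd)
      rw [SimpleGraph.fromEdgeSet_adj] at hu hv
      have h : s(u, u') = s(v, v') := f.injective (Fin.succ_injective _ (hu.1.2.trans hv.1.2.symm))
      rcases Sym2.eq_iff.mp h with ⟨h1, h2⟩ | ⟨h1, h2⟩
      · subst h1
        simp
      · subst h1 h2
        apply le_of_eq
        rw [SimpleGraph.edist_eq_one_iff_adj]
        simpa [edgeGraph] using hu
  exact ⟨Nat.sInf_mem key, fun _ h => Nat.sInf_le h⟩

/-! The upper bounds come from colouring edges greedily. For diameter 2, the parts are stars. For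
diameter 4, remove all edges meeting the neighbourhood of a vertex of degree above `ε n`: this
isolates more than `ε n` vertices each time, and once all degrees are small, few edges remain
(`exists_coloring_four`). For diameter 3, remove the edges between the neighbourhoods of two
adjacent vertices; counting four-cycles shows that some choice removes at least `m ^ 3 / n ^ 4` of
the `m` edges, so the potential `n ^ 4 / m ^ 2` grows by at least one per removal
(`exists_coloring_three`).

The lower bounds count edges: if every subgraph of diameter at most `d` has at most `K` edges, then
`m ≤ ε n ^ 2 + ℓ K`. The graphs are blow-ups of bipartite graphs (`exists_bipartite_blowup`). For
diameter 4, blow up a perfect matching. For diameter 2, a connected bipartite piece is complete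
bipartite, and a random dense relation has no large one. For diameter 3, blow up the point-line
incidence graph of the plane over `ZMod p`, which has `p ^ 3` edges. There a subgraph of diameter 3
is a set of points and lines closed under joining and meeting; a prime field has no proper subplane,
so such a set is degenerate and has at most `5 p` incidences
(`IsClosedConfiguration.card_incidences_le`). -/

/-! ### Diameters via walks, and partitions as colourings -/

/-- Distances inside `edgeGraph F` are lengths of walks that use edges from `F`. -/
theorem ediam_edgeGraph_le_iff {V : Type*} {F : Set (Sym2 V)} {d : ℕ} :
    (edgeGraph F).ediam ≤ d ↔ ∀ x ∈ (SimpleGraph.fromEdgeSet F).support,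
      ∀ y ∈ (SimpleGraph.fromEdgeSet F).support,
        ∃ p : (SimpleGraph.fromEdgeSet F).Walk x y, p.length ≤ d := by
  constructor
  · intro h x hx y hy
    have h1 : (edgeGraph F).edist ⟨x, hx⟩ ⟨y, hy⟩ ≤ d := SimpleGraph.edist_le_ediam.trans h
    obtain ⟨p, hp⟩ := SimpleGraph.exists_walk_of_edist_ne_top
      (ne_top_of_le_ne_top (ENat.natCast_ne_top d) h1)
    let f : edgeGraph F →g SimpleGraph.fromEdgeSet F := (SimpleGraph.Embedding.induce _).toHom
    rw [← hp] at h1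
    exact ⟨p.map f, (SimpleGraph.Walk.length_map f p).le.trans (by exact_mod_cast h1)⟩
  · intro h
    have key : ∀ (x y : V) (p : (SimpleGraph.fromEdgeSet F).Walk x y)
        (hx : x ∈ (SimpleGraph.fromEdgeSet F).support)
        (hy : y ∈ (SimpleGraph.fromEdgeSet F).support),
        (edgeGraph F).edist ⟨x, hx⟩ ⟨y, hy⟩ ≤ p.length := by
      intro x y p
      induction p with
      | nil => intro hx hy; simp
      | @cons u v w huv p ih =>
        intro hx hy
        have hv : v ∈ (SimpleGraph.fromEdgeSet F).support :=
          (SimpleGraph.mem_support _).2 ⟨u, huv.symm⟩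
        have h1 : (edgeGraph F).edist ⟨u, hx⟩ ⟨v, hv⟩ ≤ 1 := by
          apply le_of_eq
          rw [SimpleGraph.edist_eq_one_iff_adj]
          exact huv
        calc (edgeGraph F).edist ⟨u, hx⟩ ⟨w, hy⟩
            ≤ (edgeGraph F).edist ⟨u, hx⟩ ⟨v, hv⟩ + (edgeGraph F).edist ⟨v, hv⟩ ⟨w, hy⟩ :=
              SimpleGraph.edist_triangle
          _ ≤ 1 + p.length := add_le_add h1 (ih hv hy)
          _ = ((SimpleGraph.Walk.cons huv p).length : ℕ∞) := by
              rw [SimpleGraph.Walk.length_cons]; push_cast; rw [add_comm]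
    apply SimpleGraph.ediam_le_of_edist_le
    rintro ⟨x, hx⟩ ⟨y, hy⟩
    obtain ⟨p, hp⟩ := h x hx y hy
    exact (key x y p hx hy).trans (by exact_mod_cast hp)

/-- A set of edges all of whose vertices can be joined to `v` by a walk of length at most `r` has
diameter at most `2 r`. -/
theorem ediam_edgeGraph_le_of_center {V : Type*} {F : Set (Sym2 V)} {r : ℕ} (v : V)
    (h : ∀ x ∈ (SimpleGraph.fromEdgeSet F).support,
      ∃ p : (SimpleGraph.fromEdgeSet F).Walk x v, p.length ≤ r) :
    (edgeGraph F).ediam ≤ (2 * r : ℕ) := by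
  rw [ediam_edgeGraph_le_iff]
  intro x hx y hy
  obtain ⟨p, hp⟩ := h x hx
  obtain ⟨q, hq⟩ := h y hy
  refine ⟨p.append q.reverse, ?_⟩
  rw [SimpleGraph.Walk.length_append, SimpleGraph.Walk.length_reverse]
  omega

/-- A colouring of the edges of `G` with colours `0, …, k` in which at most `t` edges have colour
`0` and every other colour class has diameter at most `d`. -/
def HasLowDiamColoring {V : Type*} (G : SimpleGraph V) (d : ℕ) (t : ℝ) (k : ℕ) : Prop :=
  ∃ c : Sym2 V → ℕ, (∀ e ∈ G.edgeSet, c e ≤ k) ∧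
    (({e | e ∈ G.edgeSet ∧ c e = 0} : Set (Sym2 V)).ncard : ℝ) ≤ t ∧
    ∀ i, i ≠ 0 → (edgeGraph {e | e ∈ G.edgeSet ∧ c e = i}).ediam ≤ (d : ℕ∞)

theorem HasLowDiamColoring.mono {V : Type*} {G : SimpleGraph V} {d : ℕ} {t : ℝ} {k k' : ℕ}
    (h : HasLowDiamColoring G d t k) (hk : k ≤ k') : HasLowDiamColoring G d t k' := by
  obtain ⟨c, h1, h2⟩ := h
  exact ⟨c, fun e he => (h1 e he).trans hk, h2⟩

theorem ediam_edgeGraph_empty {V : Type*} {F : Set (Sym2 V)} (hF : F = ∅) (d : ℕ) :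
    (edgeGraph F).ediam ≤ d := by
  subst hF
  rw [ediam_edgeGraph_le_iff]
  intro x hx
  obtain ⟨y, hy⟩ := (SimpleGraph.mem_support _).1 hx
  simp at hy

theorem HasLowDiamColoring.of_ncard_le {V : Type*} {G : SimpleGraph V} {d : ℕ} {t : ℝ}
    (h : (G.edgeSet.ncard : ℝ) ≤ t) : HasLowDiamColoring G d t 0 := by
  refine ⟨fun _ => 0, fun _ _ => le_rfl, by simpa using h, fun i hi => ?_⟩
  apply ediam_edgeGraph_empty
  ext e
  simp [hi.symm]

/-- The greedy step: `F` receives the colour `k + 1`, which no remaining edge uses. -/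
theorem HasLowDiamColoring.of_deleteEdges {V : Type*} {G : SimpleGraph V} {d : ℕ} {t : ℝ} {k : ℕ}
    {F : Set (Sym2 V)} (hF : F ⊆ G.edgeSet) (hd : (edgeGraph F).ediam ≤ (d : ℕ∞))
    (h : HasLowDiamColoring (G.deleteEdges F) d t k) : HasLowDiamColoring G d t (k + 1) := by
  classical
  obtain ⟨c, h1, h2, h3⟩ := h
  rw [SimpleGraph.edgeSet_deleteEdges] at h1 h2 h3
  have hset : ∀ i, i ≠ k + 1 → {e | e ∈ G.edgeSet ∧ (if e ∈ F then k + 1 else c e) = i} =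
      {e | e ∈ G.edgeSet \ F ∧ c e = i} := by
    intro i hi
    ext e
    by_cases he : e ∈ F
    · simp [he, hi.symm]
    · simp [he]
  refine ⟨fun e => if e ∈ F then k + 1 else c e, ?_, ?_, ?_⟩
  · intro e he
    by_cases heF : e ∈ F
    · simp [heF]
    · simpa [heF] using (h1 e ⟨he, heF⟩).trans (Nat.le_succ k)
  · rw [hset 0 (Nat.succ_ne_zero k).symm]
    exact h2
  · intro i hi
    by_cases hik : i = k + 1
    · have : {e | e ∈ G.edgeSet ∧ (if e ∈ F then k + 1 else c e) = i} = F := by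
        ext e
        by_cases he : e ∈ F
        · simp [he, hik, hF he]
        · simp only [Set.mem_ofPred_eq, he, if_false, iff_false, not_and]
          intro heG hc
          have := h1 e ⟨heG, he⟩
          omega
      rw [this]
      exact hd
    · rw [hset i hik]
      exact h3 i hi

theorem lowDiamNumber_le_of_coloring {n : ℕ} {ε : ℝ} {d k : ℕ}
    (h : ∀ G : SimpleGraph (Fin n), HasLowDiamColoring G d (ε * (n : ℝ) ^ 2) k) :
    lowDiamNumber n ε d ≤ k := by
  apply Nat.sInf_le
  intro G
  obtain ⟨c, h1, h2, h3⟩ := h G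
  refine ⟨fun i => {e | e ∈ G.edgeSet ∧ c e = i}, ?_, ?_, by simpa using h2, ?_⟩
  · ext e
    simp only [Set.mem_iUnion, Set.mem_ofPred_eq]
    constructor
    · rintro ⟨i, hi, -⟩
      exact hi
    · intro he
      exact ⟨⟨c e, Nat.lt_succ_of_le (h1 e he)⟩, he, rfl⟩
  · intro i j hij
    rw [Set.disjoint_left]
    rintro e ⟨_, hi⟩ ⟨_, hj⟩
    exact hij (Fin.ext (hi.symm.trans hj))
  · intro i hi
    exact h3 i (fun h => hi (Fin.ext h))

/-! ### Upper bound for diameter two -/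

theorem lowDiamNumber_two_le (n : ℕ) {ε : ℝ} (hε : 0 ≤ ε) : lowDiamNumber n ε 2 ≤ n := by
  apply lowDiamNumber_le_of_coloring
  intro G
  -- Each edge joins the star at its smaller endpoint; the shift by one keeps the exceptional colour
  -- empty.
  refine ⟨fun e => (e.inf : Fin n) + 1, fun e _ => Nat.succ_le_of_lt e.inf.2, ?_, ?_⟩
  · have : ({e | e ∈ G.edgeSet ∧ ((e.inf : Fin n) : ℕ) + 1 = 0} : Set (Sym2 (Fin n))) = ∅ := by
      ext e; simp
    rw [this, Set.ncard_empty, Nat.cast_zero]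
    positivity
  · intro i hi
    by_cases hin : i - 1 < n
    · refine ediam_edgeGraph_le_of_center (r := 1) ⟨i - 1, hin⟩ ?_
      intro x hx
      obtain ⟨y, hxy⟩ := (SimpleGraph.mem_support _).1 hx
      have h1 : ((x ⊓ y : Fin n) : ℕ) + 1 = i := ((SimpleGraph.fromEdgeSet_adj _).1 hxy).1.2
      rcases le_total x y with h | h
      · rw [inf_eq_left.2 h] at h1
        have : x = ⟨i - 1, hin⟩ := Fin.ext (by simp; omega)
        subst this
        exact ⟨SimpleGraph.Walk.nil, by simp⟩
      · rw [inf_eq_right.2 h] at h1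
        have : y = ⟨i - 1, hin⟩ := Fin.ext (by simp; omega)
        subst this
        exact ⟨SimpleGraph.Walk.cons hxy SimpleGraph.Walk.nil, by simp⟩
    · apply ediam_edgeGraph_empty
      ext e
      have := e.inf.2
      simp only [Set.mem_ofPred_eq, Set.mem_empty_iff_false, iff_false, not_and]
      omega

theorem adj_fromEdgeSet_of_subset {V : Type*} {G : SimpleGraph V} {F : Set (Sym2 V)}
    (hF : F ⊆ G.edgeSet) {x y : V} : (SimpleGraph.fromEdgeSet F).Adj x y ↔ s(x, y) ∈ F := by
  rw [SimpleGraph.fromEdgeSet_adj]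
  refine ⟨fun h => h.1, fun h => ⟨h, ?_⟩⟩
  exact ((SimpleGraph.mem_edgeSet G).1 (hF h)).ne

/-! ### Upper bound for diameter four -/

open Classical in
-- If `v` has degree above `a`, the edges meeting its neighbourhood lie within distance two of `v`.
-- Removing them isolates every neighbour of `v`, so each colour is paid for by more than `a`
-- vertices that lose all their edges. If no such `v` exists, at most `a * card V / 2` edges are
-- left for colour 0.
theorem exists_coloring_four {V : Type*} [Fintype V] {a : ℝ} (ha : 0 < a) (m : ℕ) :
    ∀ G : SimpleGraph V, G.edgeSet.ncard ≤ m →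
      ∃ k : ℕ, HasLowDiamColoring G 4 (a * Fintype.card V) k ∧
        (k : ℝ) * a ≤ (Finset.univ.filter fun v => 0 < G.degree v).card := by
  induction m with
  | zero =>
    intro G hG
    refine ⟨0, .of_ncard_le ?_, by simp⟩
    have : G.edgeSet.ncard = 0 := by omega
    rw [this, Nat.cast_zero]
    positivity
  | succ m ih =>
    intro G hG
    by_cases hdeg : ∀ v, (G.degree v : ℝ) ≤ a
    · refine ⟨0, .of_ncard_le ?_, by simp⟩
      have h1 : (2 * G.edgeFinset.card : ℝ) ≤ a * Fintype.card V := by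
        have : ((∑ v, G.degree v : ℕ) : ℝ) = 2 * G.edgeFinset.card := by
          rw [G.sum_degrees_eq_twice_card_edges]; push_cast; ring
        rw [← this]
        push_cast
        calc ∑ v, (G.degree v : ℝ) ≤ ∑ _v : V, a := Finset.sum_le_sum fun v _ => hdeg v
          _ = a * Fintype.card V := by simp [mul_comm]
      rw [← G.coe_edgeFinset, Set.ncard_coe_finset]
      linarith [Nat.cast_nonneg (α := ℝ) G.edgeFinset.card]
    · push Not at hdeg
      obtain ⟨v, hv⟩ := hdeg
      set F : Set (Sym2 V) := {e | e ∈ G.edgeSet ∧ ∃ y, G.Adj v y ∧ y ∈ e} with hFdef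
      have hF : F ⊆ G.edgeSet := fun e he => he.1
      have hpos : 0 < G.degree v := by
        have : (0 : ℝ) < G.degree v := ha.trans hv
        exact_mod_cast this
      have hdel : ∀ x y, (G.deleteEdges F).Adj x y ↔ G.Adj x y ∧ ¬ G.Adj v x ∧ ¬ G.Adj v y := by
        intro x y
        rw [SimpleGraph.deleteEdges_adj]
        constructor
        · rintro ⟨h1, h2⟩
          exact ⟨h1, fun h => h2 ⟨h1, x, h, Sym2.mem_mk_left x y⟩,
            fun h => h2 ⟨h1, y, h, Sym2.mem_mk_right x y⟩⟩
        · rintro ⟨h1, h2, h3⟩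
          refine ⟨h1, ?_⟩
          rintro ⟨_, z, hz, hz'⟩
          rcases Sym2.mem_iff.1 hz' with rfl | rfl
          · exact h2 hz
          · exact h3 hz
      have hstar : ∀ y, G.Adj v y → (SimpleGraph.fromEdgeSet F).Adj y v := by
        intro y hy
        rw [adj_fromEdgeSet_of_subset hF]
        exact ⟨hy.symm, y, hy, Sym2.mem_mk_left y v⟩
      have hd : (edgeGraph F).ediam ≤ (4 : ℕ) := by
        refine ediam_edgeGraph_le_of_center (r := 2) v ?_
        intro x hx
        obtain ⟨y, hxy⟩ := (SimpleGraph.mem_support _).1 hx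
        obtain ⟨_, z, hz, hz'⟩ := (adj_fromEdgeSet_of_subset hF).1 hxy
        rcases Sym2.mem_iff.1 hz' with rfl | rfl
        · exact ⟨.cons (hstar z hz) .nil, by simp⟩
        · exact ⟨.cons hxy (.cons (hstar z hz) .nil), by simp⟩
      obtain ⟨w, hw⟩ := (G.degree_pos_iff_exists_adj v).1 hpos
      have hlt : (G.deleteEdges F).edgeSet.ncard < G.edgeSet.ncard := by
        apply Set.ncard_lt_ncard
        · rw [SimpleGraph.edgeSet_deleteEdges]
          refine ⟨Set.sdiff_subset, fun h => ?_⟩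
          exact (h ((SimpleGraph.mem_edgeSet G).2 hw)).2 ⟨hw, w, hw, Sym2.mem_mk_right v w⟩
        · exact Set.toFinite _
      obtain ⟨k, hk, hka⟩ := ih (G.deleteEdges F) (by omega)
      refine ⟨k + 1, hk.of_deleteEdges hF hd, ?_⟩
      have hsub : (Finset.univ.filter fun x => 0 < (G.deleteEdges F).degree x) ∪
          G.neighborFinset v ⊆ Finset.univ.filter fun x => 0 < G.degree x := by
        intro x hx
        simp only [Finset.mem_union, Finset.mem_filter, Finset.mem_univ, true_and,
          SimpleGraph.degree_pos_iff_exists_adj, SimpleGraph.mem_neighborFinset] at hx ⊢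
        rcases hx with ⟨y, hy⟩ | hx
        · exact ⟨y, ((hdel x y).1 hy).1⟩
        · exact ⟨v, hx.symm⟩
      have hdisj : Disjoint (Finset.univ.filter fun x => 0 < (G.deleteEdges F).degree x)
          (G.neighborFinset v) := by
        rw [Finset.disjoint_left]
        intro x hx hx'
        simp only [Finset.mem_filter, Finset.mem_univ, true_and,
          SimpleGraph.degree_pos_iff_exists_adj, SimpleGraph.mem_neighborFinset] at hx hx'
        obtain ⟨y, hy⟩ := hx
        exact ((hdel x y).1 hy).2.1 hx'
      have hcard := Finset.card_le_card hsub
      rw [Finset.card_union_of_disjoint hdisj, SimpleGraph.card_neighborFinset_eq_degree] at hcard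
      have hcard' : (((Finset.univ.filter fun x => 0 < (G.deleteEdges F).degree x).card : ℝ) +
          G.degree v) ≤ (Finset.univ.filter fun x => 0 < G.degree x).card := by
        exact_mod_cast hcard
      have hka' : (k : ℝ) * a ≤ (Finset.univ.filter fun x => 0 < (G.deleteEdges F).degree x).card := by
        convert hka
      push_cast
      linarith

theorem lowDiamNumber_four_le {n : ℕ} {ε : ℝ} (hn : 1 ≤ n) (hε : 0 < ε) :
    (lowDiamNumber n ε 4 : ℝ) ≤ 1 / ε := by
  classical
  have hn' : (0 : ℝ) < n := by exact_mod_cast hn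
  have h : lowDiamNumber n ε 4 ≤ ⌊1 / ε⌋₊ := by
    apply lowDiamNumber_le_of_coloring
    intro G
    obtain ⟨k, hk, hka⟩ := exists_coloring_four (mul_pos hε hn') _ G le_rfl
    rw [Fintype.card_fin, mul_assoc, ← sq] at hk
    refine hk.mono (Nat.le_floor ?_)
    have h1 : (k : ℝ) * (ε * n) ≤ n := by
      refine hka.trans ?_
      exact_mod_cast (Finset.card_le_univ _).trans (by simp)
    rw [le_div_iff₀ hε]
    have : (k * ε) * n ≤ 1 * (n : ℝ) := by linarith
    exact le_of_mul_le_mul_right this hn'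
  exact (Nat.cast_le.2 h).trans (Nat.floor_le (by positivity))

/-! ### Upper bound for diameter three -/

/-- The edges between the neighbourhoods of two adjacent vertices form a graph of diameter at most
three. -/
theorem ediam_edgeGraph_between_neighbors_le {V : Type*} {G : SimpleGraph V} {u v : V}
    (huv : G.Adj u v) :
    (edgeGraph {e | e ∈ G.edgeSet ∧ ∃ a b, G.Adj u a ∧ G.Adj v b ∧ e = s(a, b)}).ediam
      ≤ (3 : ℕ) := by
  set F : Set (Sym2 V) := {e | e ∈ G.edgeSet ∧ ∃ a b, G.Adj u a ∧ G.Adj v b ∧ e = s(a, b)}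
  have hF : F ⊆ G.edgeSet := fun e he => he.1
  -- As `u` and `v` are neighbours of each other, `F` contains all edges at `u` and at `v`: a double
  -- star spanning its vertices.
  have hu : ∀ a, G.Adj u a → (SimpleGraph.fromEdgeSet F).Adj a u := fun a ha =>
    (adj_fromEdgeSet_of_subset hF).2 ⟨ha.symm, a, u, ha, huv.symm, rfl⟩
  have hv : ∀ a, G.Adj v a → (SimpleGraph.fromEdgeSet F).Adj a v := fun a ha =>
    (adj_fromEdgeSet_of_subset hF).2 ⟨ha.symm, v, a, huv, ha, Sym2.eq_swap⟩
  have huv' := hv u huv.symm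
  have hsupp : ∀ x ∈ (SimpleGraph.fromEdgeSet F).support,
      (SimpleGraph.fromEdgeSet F).Adj x u ∨ (SimpleGraph.fromEdgeSet F).Adj x v := by
    intro x hx
    obtain ⟨y, hxy⟩ := (SimpleGraph.mem_support _).1 hx
    obtain ⟨_, a, b, ha, hb, hab⟩ := (adj_fromEdgeSet_of_subset hF).1 hxy
    rcases Sym2.eq_iff.1 hab with ⟨rfl, rfl⟩ | ⟨rfl, rfl⟩
    · exact .inl (hu _ ha)
    · exact .inr (hv _ hb)
  rw [ediam_edgeGraph_le_iff]
  intro x hx y hy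
  rcases hsupp x hx with h1 | h1 <;> rcases hsupp y hy with h2 | h2
  · exact ⟨.cons h1 (.cons h2.symm .nil), by simp⟩
  · exact ⟨.cons h1 (.cons huv' (.cons h2.symm .nil)), by simp⟩
  · exact ⟨.cons h1 (.cons huv'.symm (.cons h2.symm .nil)), by simp⟩
  · exact ⟨.cons h1 (.cons h2.symm .nil), by simp⟩

/-- The number of homomorphic copies of the four-cycle, in terms of a symmetric weight. -/
theorem sum_pow_four_le_card_pow_mul_sum_fourCycle {V : Type*} [Fintype V] (A : V → V → ℝ)
    (hA : ∀ u v, A u v = A v u) :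
    (∑ u, ∑ v, A u v) ^ 4 ≤
      (Fintype.card V : ℝ) ^ 4 * ∑ u, ∑ v, A u v * ∑ a, ∑ b, A u a * A v b * A a b := by
  set N : ℝ := (Fintype.card V : ℝ)
  -- Cauchy–Schwarz twice: over vertices it bounds paths of length two from below, and over pairs of
  -- their endpoints it bounds four-cycles. `h4` then reads a four-cycle from its edge `u v`.
  have h1 : (∑ u, ∑ v, A u v) ^ 2 ≤ N * ∑ u, (∑ v, A u v) ^ 2 :=
    sq_sum_le_card_mul_sum_sq
  have h2 : ∑ u, (∑ v, A u v) ^ 2 = ∑ p : V × V, ∑ u, A p.1 u * A u p.2 := by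
    rw [Finset.sum_comm]
    refine Finset.sum_congr rfl fun u _ => ?_
    rw [sq, Finset.sum_mul_sum, Fintype.sum_prod_type]
    refine Finset.sum_congr rfl fun a _ => Finset.sum_congr rfl fun b _ => ?_
    rw [hA u a]
  have h3 : (∑ p : V × V, ∑ u, A p.1 u * A u p.2) ^ 2 ≤
      N ^ 2 * ∑ p : V × V, (∑ u, A p.1 u * A u p.2) ^ 2 := by
    have := sq_sum_le_card_mul_sum_sq (s := (Finset.univ : Finset (V × V)))
      (f := fun p => ∑ u, A p.1 u * A u p.2)
    rwa [Finset.card_univ, Fintype.card_prod, Nat.cast_mul, ← sq] at this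
  have h4 : ∑ p : V × V, (∑ u, A p.1 u * A u p.2) ^ 2 =
      ∑ u, ∑ v, A u v * ∑ a, ∑ b, A u a * A v b * A a b := by
    rw [Fintype.sum_prod_type]
    simp_rw [sq, Finset.sum_mul_sum, Finset.mul_sum]
    calc ∑ a, ∑ v, ∑ u, ∑ b, A a u * A u v * (A a b * A b v)
        = ∑ a, ∑ u, ∑ v, ∑ b, A a u * A u v * (A a b * A b v) :=
          Finset.sum_congr rfl fun a _ => Finset.sum_comm
      _ = ∑ u, ∑ a, ∑ v, ∑ b, A a u * A u v * (A a b * A b v) := Finset.sum_comm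
      _ = ∑ u, ∑ v, ∑ a, ∑ b, A a u * A u v * (A a b * A b v) :=
          Finset.sum_congr rfl fun a _ => Finset.sum_comm
      _ = _ := by
          refine Finset.sum_congr rfl fun u _ => Finset.sum_congr rfl fun v _ =>
            Finset.sum_congr rfl fun a _ => Finset.sum_congr rfl fun b _ => ?_
          rw [hA a u, hA b v]
          ring
  have h5 : 0 ≤ ∑ u, (∑ v, A u v) ^ 2 := Finset.sum_nonneg fun u _ => sq_nonneg _
  calc (∑ u, ∑ v, A u v) ^ 4 = ((∑ u, ∑ v, A u v) ^ 2) ^ 2 := by ring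
    _ ≤ (N * ∑ u, (∑ v, A u v) ^ 2) ^ 2 := by gcongr
    _ = N ^ 2 * (∑ p : V × V, ∑ u, A p.1 u * A u p.2) ^ 2 := by rw [h2]; ring
    _ ≤ N ^ 2 * (N ^ 2 * ∑ p : V × V, (∑ u, A p.1 u * A u p.2) ^ 2) := by gcongr
    _ = _ := by rw [h4]; ring

/-- Some two adjacent vertices have many edges between their neighbourhoods. -/
theorem exists_subset_edgeSet_ediam_le_three {V : Type*} [Fintype V] (G : SimpleGraph V)
    (hm : 0 < G.edgeSet.ncard) :
    ∃ F ⊆ G.edgeSet, (edgeGraph F).ediam ≤ (3 : ℕ) ∧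
      (G.edgeSet.ncard : ℝ) ^ 3 ≤ (Fintype.card V : ℝ) ^ 4 * F.ncard := by
  classical
  set A : V → V → ℝ := fun u v => if G.Adj u v then 1 else 0 with hAdef
  have hA : ∀ u v, A u v = A v u := fun u v => by simp [hAdef, G.adj_comm]
  set m : ℝ := (G.edgeSet.ncard : ℝ) with hmdef
  have hm0 : 0 < m := Nat.cast_pos.2 hm
  set N : ℝ := (Fintype.card V : ℝ) with hN
  have hsum : ∑ u, ∑ v, A u v = 2 * m := by
    have h1 : ∀ u, ∑ v, A u v = G.degree u := by
      intro u
      simp only [hAdef, Finset.sum_boole]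
      rw [← G.card_neighborFinset_eq_degree, SimpleGraph.neighborFinset_eq_filter]
    simp only [h1]
    rw [hmdef, ← G.coe_edgeFinset, Set.ncard_coe_finset]
    exact_mod_cast G.sum_degrees_eq_twice_card_edges
  have h4 := sum_pow_four_le_card_pow_mul_sum_fourCycle A hA
  rw [hsum] at h4
  by_contra! hcon
  -- An edge of `F` arises from at most two ordered pairs `(a, b)`, hence the inner factor 2.
  -- Summing over the `2 m` ordered adjacent pairs gives `(2 m) ^ 4 ≤ 4 m ^ 4`, which is absurd.
  have key : ∀ u v, A u v * ∑ a, ∑ b, A u a * A v b * A a b ≤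
      A u v * (2 * (m ^ 3 / N ^ 4)) := by
    intro u v
    by_cases huv : G.Adj u v
    · have hlt := hcon {e | e ∈ G.edgeSet ∧ ∃ a b, G.Adj u a ∧ G.Adj v b ∧ e = s(a, b)}
        (fun e he => he.1) (ediam_edgeGraph_between_neighbors_le huv)
      set F : Set (Sym2 V) :=
        {e | e ∈ G.edgeSet ∧ ∃ a b, G.Adj u a ∧ G.Adj v b ∧ e = s(a, b)} with hF
      have hN0 : 0 < N := by
        rw [hN]
        exact_mod_cast Fintype.card_pos_iff.2 ⟨u⟩
      set P : Finset (V × V) := Finset.univ.filter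
        fun p => G.Adj u p.1 ∧ G.Adj v p.2 ∧ G.Adj p.1 p.2 with hP
      have hsumP : ∑ a, ∑ b, A u a * A v b * A a b = P.card := by
        rw [← Fintype.sum_prod_type' (f := fun a b => A u a * A v b * A a b), hP,
          Finset.card_filter, Nat.cast_sum]
        refine Finset.sum_congr rfl fun p _ => ?_
        simp only [hAdef]
        by_cases h1 : G.Adj u p.1 <;> by_cases h2 : G.Adj v p.2 <;> by_cases h3 : G.Adj p.1 p.2 <;>
          simp [h1, h2, h3]
      have hPF : P.card ≤ 2 * F.ncard := by
        have hfin : F.Finite := Set.toFinite _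
        rw [Set.ncard_eq_toFinset_card F hfin]
        refine Finset.card_le_mul_card_image_of_maps_to (f := fun p : V × V => s(p.1, p.2)) ?_ 2 ?_
        · intro p hp
          rw [hP, Finset.mem_filter] at hp
          rw [Set.Finite.mem_toFinset]
          exact ⟨hp.2.2.2, p.1, p.2, hp.2.1, hp.2.2.1, rfl⟩
        · intro e _
          induction e with | _ x y =>
          refine (Finset.card_le_card (t := {(x, y), (y, x)}) ?_).trans Finset.card_le_two
          rintro ⟨a, b⟩ hp
          rw [Finset.mem_filter] at hp
          rcases Sym2.eq_iff.1 hp.2 with ⟨rfl, rfl⟩ | ⟨rfl, rfl⟩ <;> simp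
      have h1 : (F.ncard : ℝ) ≤ m ^ 3 / N ^ 4 := by
        rw [le_div_iff₀ (by positivity)]
        linarith
      have hPF' : (P.card : ℝ) ≤ 2 * F.ncard := by exact_mod_cast hPF
      have : A u v = 1 := by simp [hAdef, huv]
      rw [hsumP, this]
      linarith
    · simp [hAdef, huv]
  have hle : ∑ u, ∑ v, A u v * ∑ a, ∑ b, A u a * A v b * A a b ≤ 2 * m * (2 * (m ^ 3 / N ^ 4)) := by
    rw [← hsum, Finset.sum_mul]
    refine Finset.sum_le_sum fun u _ => ?_
    rw [Finset.sum_mul]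
    exact Finset.sum_le_sum fun v _ => key u v
  have hN0 : 0 < N := by
    rcases (Set.ncard_pos).1 hm with ⟨e, he⟩
    induction e with | _ x y =>
    rw [hN]
    exact_mod_cast Fintype.card_pos_iff.2 ⟨x⟩
  have h5 : (2 * m) ^ 4 ≤ N ^ 4 * (2 * m * (2 * (m ^ 3 / N ^ 4))) :=
    h4.trans (mul_le_mul_of_nonneg_left hle (by positivity))
  have h6 : N ^ 4 * (2 * m * (2 * (m ^ 3 / N ^ 4))) = 4 * m ^ 4 := by
    field_simp
    ring
  rw [h6] at h5
  have : 0 < m ^ 4 := by positivity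
  nlinarith

/-- The potential `N ^ 4 / m ^ 2` increases by at least one with each removal and stays below `N ^ 4
/ t ^ 2` while more than `t` edges remain; the extra 1 pays for the last removal. -/
theorem exists_coloring_three {V : Type*} [Fintype V] {t : ℝ} (ht : 0 < t) (m : ℕ) :
    ∀ G : SimpleGraph V, G.edgeSet.ncard ≤ m → t < G.edgeSet.ncard →
      ∃ k : ℕ, HasLowDiamColoring G 3 t k ∧
        (k : ℝ) ≤ 1 + (Fintype.card V : ℝ) ^ 4 / t ^ 2 -
          (Fintype.card V : ℝ) ^ 4 / (G.edgeSet.ncard : ℝ) ^ 2 := by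
  induction m with
  | zero =>
    intro G hG hlt
    have : G.edgeSet.ncard = 0 := by omega
    rw [this, Nat.cast_zero] at hlt
    linarith
  | succ m ih =>
    intro G hG hlt
    have hm0 : (0 : ℝ) < G.edgeSet.ncard := ht.trans hlt
    have hm0' : 0 < G.edgeSet.ncard := by exact_mod_cast hm0
    obtain ⟨F, hF, hd, hFcard⟩ := exists_subset_edgeSet_ediam_le_three G hm0'
    have hcard : ((G.deleteEdges F).edgeSet.ncard : ℝ) = G.edgeSet.ncard - F.ncard := by
      rw [SimpleGraph.edgeSet_deleteEdges, eq_sub_iff_add_eq]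
      exact_mod_cast Set.ncard_sdiff_add_ncard_of_subset hF (Set.toFinite _)
    set N4 : ℝ := (Fintype.card V : ℝ) ^ 4 with hN4
    have hN0 : 0 ≤ N4 := by positivity
    set x : ℝ := (G.edgeSet.ncard : ℝ) with hx
    set y : ℝ := ((G.deleteEdges F).edgeSet.ncard : ℝ) with hy
    set f : ℝ := (F.ncard : ℝ) with hf
    have hNf : 0 < N4 * f := lt_of_lt_of_le (by positivity) hFcard
    have hf0 : 0 < f := pos_of_mul_pos_right hNf hN0
    by_cases hcase : y ≤ t
    · refine ⟨1, (HasLowDiamColoring.of_ncard_le hcase).of_deleteEdges hF hd, ?_⟩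
      have : N4 / x ^ 2 ≤ N4 / t ^ 2 := by gcongr
      push_cast
      linarith
    · push Not at hcase
      have hlt' : (G.deleteEdges F).edgeSet.ncard < G.edgeSet.ncard := by
        have : y < x := by linarith
        exact Nat.cast_lt.1 this
      obtain ⟨k, hk, hkb⟩ := ih (G.deleteEdges F) (by omega) hcase
      refine ⟨k + 1, hk.of_deleteEdges hF hd, ?_⟩
      have hy0 : 0 < y := ht.trans hcase
      -- Since `y ≤ x`, it suffices to compare with `N4 / (x * y)`, whose excess over `N4 / x ^ 2`
      -- is `N4 * f / (x ^ 2 * y) ≥ x / y ≥ 1`.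
      have hmain : 1 + N4 / x ^ 2 ≤ N4 / y ^ 2 := by
        have hyx : y ^ 2 ≤ x * y := by nlinarith
        have h2 : N4 / (x * y) ≤ N4 / y ^ 2 := by gcongr
        refine le_trans ?_ h2
        have h3 : N4 / (x * y) - N4 / x ^ 2 = N4 * f / (x ^ 2 * y) := by
          rw [hcard] at hy0 ⊢
          field_simp
          ring
        have h4 : 1 ≤ N4 * f / (x ^ 2 * y) := by
          rw [le_div_iff₀ (by positivity)]
          have : x ^ 2 * y ≤ x ^ 2 * x := by gcongr; linarith
          nlinarith
        linarith
      push_cast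
      linarith

theorem lowDiamNumber_three_le {n : ℕ} {ε : ℝ} (hn : 1 ≤ n) (hε : 0 < ε) :
    (lowDiamNumber n ε 3 : ℝ) ≤ 2 / ε ^ 2 := by
  have hn' : (0 : ℝ) < n := by exact_mod_cast hn
  have h : lowDiamNumber n ε 3 ≤ ⌊2 / ε ^ 2⌋₊ := by
    apply lowDiamNumber_le_of_coloring
    intro G
    by_cases hG : (G.edgeSet.ncard : ℝ) ≤ ε * (n : ℝ) ^ 2
    · exact (HasLowDiamColoring.of_ncard_le hG).mono (Nat.zero_le _)
    push Not at hG
    obtain ⟨k, hk, hkb⟩ := exists_coloring_three (by positivity) _ G le_rfl hG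
    refine hk.mono (Nat.le_floor ?_)
    rw [Fintype.card_fin] at hkb
    have hcard : (G.edgeSet.ncard : ℝ) ≤ (n : ℝ) ^ 2 := by
      classical
      rw [← G.coe_edgeFinset, Set.ncard_coe_finset]
      have h1 := G.card_edgeFinset_le_card_choose_two
      rw [Fintype.card_fin] at h1
      exact_mod_cast h1.trans (Nat.choose_le_pow n 2)
    -- A graph with more than `ε n ^ 2` edges forces `ε ≤ 1`, so the extra 1 is absorbed by `1 / ε ^
    -- 2`.
    have hε1 : ε ≤ 1 := by
      by_contra! hcon
      nlinarith [sq_nonneg (n : ℝ)]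
    have h1 : (n : ℝ) ^ 4 / (ε * (n : ℝ) ^ 2) ^ 2 = 1 / ε ^ 2 := by
      field_simp
    have h2 : (1 : ℝ) ≤ 1 / ε ^ 2 := by
      rw [le_div_iff₀ (by positivity)]
      nlinarith
    have h3 : 0 ≤ (n : ℝ) ^ 4 / (G.edgeSet.ncard : ℝ) ^ 2 := by positivity
    rw [h1] at hkb
    have h4 : 2 / ε ^ 2 = 1 / ε ^ 2 + 1 / ε ^ 2 := by ring
    linarith
  exact (Nat.cast_le.2 h).trans (Nat.floor_le (by positivity))

/-! ### Lower bounds by counting edges -/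

theorem ncard_edgeSet_le_of_partition {n : ℕ} {G : SimpleGraph (Fin n)} {ε : ℝ} {d ℓ : ℕ}
    {E : Fin (ℓ + 1) → Set (Sym2 (Fin n))} (hE : IsLowDiamPartition G ε d ℓ E) {K : ℝ}
    (hK : ∀ F ⊆ G.edgeSet, (edgeGraph F).ediam ≤ (d : ℕ∞) → (F.ncard : ℝ) ≤ K) :
    (G.edgeSet.ncard : ℝ) ≤ ε * (n : ℝ) ^ 2 + ℓ * K := by
  classical
  have h1 : G.edgeSet.ncard ≤ ∑ i, (E i).ncard := by
    have : G.edgeSet = ((Finset.univ.biUnion fun i => (E i).toFinset : Finset (Sym2 (Fin n))) :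
        Set (Sym2 (Fin n))) := by
      rw [← hE.iUnion_eq]
      ext e
      simp
    rw [this, Set.ncard_coe_finset]
    refine Finset.card_biUnion_le.trans (Finset.sum_le_sum fun i _ => ?_)
    rw [Set.ncard_eq_toFinset_card']
  rw [Fin.sum_univ_succ] at h1
  have h2 : ∀ i : Fin ℓ, ((E i.succ).ncard : ℝ) ≤ K := fun i =>
    hK _ (hE.iUnion_eq ▸ Set.subset_iUnion E i.succ) (hE.diam_le _ (Fin.succ_ne_zero i))
  calc (G.edgeSet.ncard : ℝ) ≤ (E 0).ncard + ∑ i : Fin ℓ, ((E i.succ).ncard : ℝ) := by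
        exact_mod_cast h1
    _ ≤ ε * (n : ℝ) ^ 2 + ∑ _i : Fin ℓ, K := add_le_add hE.exceptional
        (Finset.sum_le_sum fun i _ => h2 i)
    _ = _ := by simp

theorem ncard_edgeSet_le_lowDiamNumber {n : ℕ} {ε : ℝ} {d : ℕ} (hε : 0 ≤ ε) (hd : 1 ≤ d)
    (G : SimpleGraph (Fin n)) {K : ℝ}
    (hK : ∀ F ⊆ G.edgeSet, (edgeGraph F).ediam ≤ (d : ℕ∞) → (F.ncard : ℝ) ≤ K) :
    (G.edgeSet.ncard : ℝ) ≤ ε * (n : ℝ) ^ 2 + lowDiamNumber n ε d * K := by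
  obtain ⟨E, hE⟩ := (lowDiamNumber_isLeast n ε d hε hd).1 G
  exact ncard_edgeSet_le_of_partition hE hK

/-- The complete graph cannot be entirely exceptional. This settles the ranges in which the desired
lower bound is at most one. -/
theorem one_le_lowDiamNumber {n : ℕ} {ε : ℝ} {d : ℕ} (hε : 0 ≤ ε) (hd : 1 ≤ d)
    (h : ε * (n : ℝ) ^ 2 < (n.choose 2 : ℝ)) : (1 : ℝ) ≤ lowDiamNumber n ε d := by
  classical
  by_contra! hcon
  have h0 : lowDiamNumber n ε d = 0 := by
    have : lowDiamNumber n ε d < 1 := by exact_mod_cast hcon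
    omega
  have h1 := ncard_edgeSet_le_lowDiamNumber hε hd (⊤ : SimpleGraph (Fin n))
    (K := ((⊤ : SimpleGraph (Fin n)).edgeSet.ncard : ℝ))
    (fun F hF _ => by exact_mod_cast Set.ncard_le_ncard hF (Set.toFinite _))
  rw [h0, ← SimpleGraph.coe_edgeFinset, Set.ncard_coe_finset,
    SimpleGraph.card_edgeFinset_top_eq_card_choose_two, Fintype.card_fin] at h1
  simp only [Nat.cast_zero, zero_mul, add_zero] at h1
  linarith

/-! ### Bipartite graphs of small diameter and their blow-ups -/

/-- The bipartite graph of a relation between two types. -/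
def bipartiteGraph {α β : Type*} (R : Set (α × β)) : SimpleGraph (α ⊕ β) where
  Adj x y := ∃ a b, (a, b) ∈ R ∧ (x = .inl a ∧ y = .inr b ∨ x = .inr b ∧ y = .inl a)
  symm := ⟨by
    rintro x y ⟨a, b, h, h' | h'⟩
    · exact ⟨a, b, h, .inr ⟨h'.2, h'.1⟩⟩
    · exact ⟨a, b, h, .inl ⟨h'.2, h'.1⟩⟩⟩
  loopless := ⟨by
    rintro x ⟨a, b, h, ⟨rfl, h'⟩ | ⟨rfl, h'⟩⟩ <;> cases h'⟩

section bipartiteGraph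

variable {α β : Type*} {R : Set (α × β)}

@[simp] theorem bipartiteGraph_adj_inl_inr {a : α} {b : β} :
    (bipartiteGraph R).Adj (.inl a) (.inr b) ↔ (a, b) ∈ R := by
  simp [bipartiteGraph]

@[simp] theorem bipartiteGraph_adj_inr_inl {a : α} {b : β} :
    (bipartiteGraph R).Adj (.inr b) (.inl a) ↔ (a, b) ∈ R := by
  rw [SimpleGraph.adj_comm, bipartiteGraph_adj_inl_inr]

@[simp] theorem not_bipartiteGraph_adj_inl_inl {a a' : α} :
    ¬ (bipartiteGraph R).Adj (.inl a) (.inl a') := by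
  simp [bipartiteGraph]

@[simp] theorem not_bipartiteGraph_adj_inr_inr {b b' : β} :
    ¬ (bipartiteGraph R).Adj (.inr b) (.inr b') := by
  simp [bipartiteGraph]

theorem inl_mem_support_bipartiteGraph {a : α} :
    .inl a ∈ (bipartiteGraph R).support ↔ ∃ b, (a, b) ∈ R := by
  rw [SimpleGraph.mem_support, Sum.exists]
  simp

theorem inr_mem_support_bipartiteGraph {b : β} :
    .inr b ∈ (bipartiteGraph R).support ↔ ∃ a, (a, b) ∈ R := by
  rw [SimpleGraph.mem_support, Sum.exists]
  simp

/-- Any two non-isolated vertices of the bipartite graph of `R` are joined by a walk of length at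
most `d`. -/
def BipartiteDiamLE (R : Set (α × β)) (d : ℕ) : Prop :=
  ∀ x ∈ (bipartiteGraph R).support, ∀ y ∈ (bipartiteGraph R).support,
    ∃ p : (bipartiteGraph R).Walk x y, p.length ≤ d

/-- A walk between opposite sides has odd length, so length at most two means a single edge: the
graph is complete bipartite. -/
theorem BipartiteDiamLE.mem (h : BipartiteDiamLE R 2) {a a' : α} {b b' : β} (hab : (a, b) ∈ R)
    (hab' : (a', b') ∈ R) : (a, b') ∈ R := by
  obtain ⟨p, hp⟩ := h (.inl a) (inl_mem_support_bipartiteGraph.2 ⟨b, hab⟩) (.inr b')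
    (inr_mem_support_bipartiteGraph.2 ⟨a', hab'⟩)
  rcases p with _ | ⟨h1, _ | ⟨h2, _ | ⟨h3, p⟩⟩⟩
  · simpa using h1
  · rename_i v
    rcases v with v | v <;> simp at h1 h2
  · simp only [SimpleGraph.Walk.length_cons] at hp
    omega

/-- A walk between vertices of one side has even length, so length at most three means zero or two.
-/
theorem BipartiteDiamLE.exists_common_right (h : BipartiteDiamLE R 3) {a a' : α} {b b' : β}
    (hab : (a, b) ∈ R) (hab' : (a', b') ∈ R) : ∃ b, (a, b) ∈ R ∧ (a', b) ∈ R := by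
  obtain ⟨p, hp⟩ := h (.inl a) (inl_mem_support_bipartiteGraph.2 ⟨b, hab⟩) (.inl a')
    (inl_mem_support_bipartiteGraph.2 ⟨b', hab'⟩)
  rcases p with _ | ⟨h1, _ | ⟨h2, _ | ⟨h3, _ | ⟨h4, p⟩⟩⟩⟩
  · exact ⟨b, hab, hab⟩
  · simp at h1
  · rename_i v
    rcases v with v | v
    · simp at h1
    · exact ⟨v, by simpa using h1, by simpa using h2⟩
  · rename_i v w
    rcases v with v | v <;> rcases w with w | w <;> simp at h1 h2 h3
  · simp only [SimpleGraph.Walk.length_cons] at hp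
    omega

theorem BipartiteDiamLE.exists_common_left (h : BipartiteDiamLE R 3) {a a' : α} {b b' : β}
    (hab : (a, b) ∈ R) (hab' : (a', b') ∈ R) : ∃ a, (a, b) ∈ R ∧ (a, b') ∈ R := by
  obtain ⟨p, hp⟩ := h (.inr b) (inr_mem_support_bipartiteGraph.2 ⟨a, hab⟩) (.inr b')
    (inr_mem_support_bipartiteGraph.2 ⟨a', hab'⟩)
  rcases p with _ | ⟨h1, _ | ⟨h2, _ | ⟨h3, _ | ⟨h4, p⟩⟩⟩⟩
  · exact ⟨a, hab, hab⟩
  · simp at h1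
  · rename_i v
    rcases v with v | v
    · exact ⟨v, by simpa using h1, by simpa using h2⟩
    · simp at h1
  · rename_i v w
    rcases v with v | v <;> rcases w with w | w <;> simp at h1 h2 h3
  · simp only [SimpleGraph.Walk.length_cons] at hp
    omega

end bipartiteGraph

/-- Along edges of a diagonal relation the underlying element is constant, so connectedness leaves a
single pair. -/
theorem BipartiteDiamLE.eq_of_subset_diagonal {α : Type*} {R : Set (α × α)} {d : ℕ}
    (h : BipartiteDiamLE R d) (hR : R ⊆ Set.diagonal α) {x y : α × α} (hx : x ∈ R) (hy : y ∈ R) :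
    x = y := by
  obtain ⟨p, -⟩ := h (.inl x.1) (inl_mem_support_bipartiteGraph.2 ⟨x.2, hx⟩) (.inl y.1)
    (inl_mem_support_bipartiteGraph.2 ⟨y.2, hy⟩)
  have key : ∀ u v (_ : (bipartiteGraph R).Walk u v), u.elim id id = v.elim id id := by
    intro u v p
    induction p with
    | nil => rfl
    | cons huv p ih =>
      rw [← ih]
      obtain ⟨a, b, hab, ⟨rfl, rfl⟩ | ⟨rfl, rfl⟩⟩ := huv
      · exact hR hab
      · exact (hR hab).symm
  have h1 : x.1 = y.1 := key _ _ p
  exact Prod.ext h1 ((hR hx).symm.trans (h1.trans (hR hy)))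

/-- Blowing up the bipartite graph of `R`, with every vertex replaced by `s` vertices. -/
theorem exists_bipartite_blowup {α β : Type*} [Fintype α] [Fintype β] [DecidableEq α]
    [DecidableEq β] (R : Finset (α × β)) {s n : ℕ}
    (hn : s * (Fintype.card α + Fintype.card β) ≤ n) :
    ∃ G : SimpleGraph (Fin n), G.edgeSet.ncard = s ^ 2 * R.card ∧
      ∀ F ⊆ G.edgeSet, ∃ R' ⊆ R, F.ncard ≤ s ^ 2 * R'.card ∧
        ∀ d : ℕ, (edgeGraph F).ediam ≤ (d : ℕ∞) → BipartiteDiamLE (R' : Set (α × β)) d := by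
  classical
  have hcard : Fintype.card ((α ⊕ β) × Fin s) ≤ Fintype.card (Fin n) := by
    simpa [mul_comm] using hn
  obtain ⟨j⟩ := Function.Embedding.nonempty_of_card_le hcard
  have hj : ∀ {x y}, j x = j y ↔ x = y := j.injective.eq_iff
  let Φ : (α × β) × (Fin s × Fin s) → Sym2 (Fin n) :=
    fun z => s(j (.inl z.1.1, z.2.1), j (.inr z.1.2, z.2.2))
  have hΦ : Function.Injective Φ := by
    rintro ⟨⟨a, b⟩, i, i'⟩ ⟨⟨a', b'⟩, k, k'⟩ h
    rcases Sym2.eq_iff.1 h with ⟨h1, h2⟩ | ⟨h1, h2⟩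
    · simp [hj] at h1 h2
      simp [h1, h2]
    · simp [hj] at h1
  have himage : ∀ S : Finset (α × β), (Φ '' {z | z.1 ∈ S}).ncard = s ^ 2 * S.card := by
    intro S
    have : {z : (α × β) × (Fin s × Fin s) | z.1 ∈ S} =
        ((S ×ˢ (Finset.univ : Finset (Fin s × Fin s)) : Finset _) : Set _) := by
      ext z; simp
    rw [Set.ncard_image_of_injective _ hΦ, this, Set.ncard_coe_finset, Finset.card_product]
    simp [sq, mul_comm]
  have hedge : (SimpleGraph.fromEdgeSet (Φ '' {z | z.1 ∈ R})).edgeSet = Φ '' {z | z.1 ∈ R} := by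
    rw [SimpleGraph.edgeSet_fromEdgeSet, sdiff_eq_left, Set.disjoint_left]
    rintro _ ⟨z, -, rfl⟩ h
    simp [Φ, hj] at h
  refine ⟨SimpleGraph.fromEdgeSet (Φ '' {z | z.1 ∈ R}), by rw [hedge, himage], ?_⟩
  intro F hF
  rw [hedge] at hF
  -- `R'` is the projection of `F`. Walks in `F` project to walks of the same length in `R'`, and
  -- every non-isolated vertex of `R'` lifts to an endpoint of `F`, so diameter bounds pass to `R'`.
  set R' := R.filter fun x => ∃ i : Fin s × Fin s, Φ (x, i) ∈ F with hR'
  have hFR' : F ⊆ Φ '' {z | z.1 ∈ R'} := by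
    intro e he
    obtain ⟨z, hz, rfl⟩ := hF he
    exact ⟨z, Finset.mem_filter.2 ⟨hz, z.2, he⟩, rfl⟩
  have hadj : ∀ {x y}, s(j x, j y) ∈ F → (bipartiteGraph (R' : Set (α × β))).Adj x.1 y.1 := by
    intro x y h
    obtain ⟨⟨⟨a, b⟩, i, i'⟩, hz, he⟩ := hFR' h
    rcases Sym2.eq_iff.1 he with ⟨h1, h2⟩ | ⟨h1, h2⟩
    · rw [hj] at h1 h2
      subst h1 h2
      exact bipartiteGraph_adj_inl_inr.2 hz
    · rw [hj] at h1 h2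
      subst h1 h2
      exact bipartiteGraph_adj_inr_inl.2 hz
  have hrange : ∀ {x : Fin n} {y}, s(x, y) ∈ F → ∃ z, j z = y := by
    intro x y h
    obtain ⟨z, hz, he⟩ := hFR' h
    rcases Sym2.eq_iff.1 he with ⟨h1, h2⟩ | ⟨h1, h2⟩
    · exact ⟨_, h2⟩
    · exact ⟨_, h1⟩
  have hwalk : ∀ u v (p : (SimpleGraph.fromEdgeSet F).Walk u v) (x y : (α ⊕ β) × Fin s),
      u = j x → v = j y →
      ∃ q : (bipartiteGraph (R' : Set (α × β))).Walk x.1 y.1, q.length = p.length := by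
    intro u v p
    induction p with
    | nil =>
      intro x y hx hy
      have : x = y := hj.1 (hx.symm.trans hy)
      subst this
      exact ⟨.nil, rfl⟩
    | cons huv p ih =>
      intro x y hx hy
      have h1 := ((SimpleGraph.fromEdgeSet_adj _).1 huv).1
      obtain ⟨z, hz⟩ := hrange h1
      obtain ⟨q, hq⟩ := ih z y hz.symm hy
      rw [hx, ← hz] at h1
      exact ⟨.cons (hadj h1) q, by simp [hq]⟩
  have hlift : ∀ x ∈ (bipartiteGraph (R' : Set (α × β))).support,
      ∃ i, j (x, i) ∈ (SimpleGraph.fromEdgeSet F).support := by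
    intro x hx
    obtain ⟨y, a, b, hab, hxy⟩ := (SimpleGraph.mem_support _).1 hx
    obtain ⟨i, hi⟩ := (Finset.mem_filter.1 hab).2
    have hadj' : (SimpleGraph.fromEdgeSet F).Adj (j (.inl a, i.1)) (j (.inr b, i.2)) := by
      rw [SimpleGraph.fromEdgeSet_adj]
      refine ⟨hi, fun h => ?_⟩
      simp [hj] at h
    rcases hxy with ⟨rfl, -⟩ | ⟨rfl, -⟩
    · exact ⟨i.1, (SimpleGraph.mem_support _).2 ⟨_, hadj'⟩⟩
    · exact ⟨i.2, (SimpleGraph.mem_support _).2 ⟨_, hadj'.symm⟩⟩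
  refine ⟨R', Finset.filter_subset _ _, ?_, ?_⟩
  · rw [← himage]
    exact Set.ncard_le_ncard hFR' (Set.toFinite _)
  · intro d hd x hx y hy
    rw [ediam_edgeGraph_le_iff] at hd
    obtain ⟨i, hi⟩ := hlift x hx
    obtain ⟨k, hk⟩ := hlift y hy
    obtain ⟨p, hp⟩ := hd _ hi _ hk
    obtain ⟨q, hq⟩ := hwalk _ _ p _ _ rfl rfl
    exact ⟨q, hq.le.trans hp⟩

theorem card_le_lowDiamNumber_of_bipartite {α β : Type*} [Fintype α] [Fintype β] [DecidableEq α]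
    [DecidableEq β] (R : Finset (α × β)) {s n d : ℕ} {ε K : ℝ}
    (hn : s * (Fintype.card α + Fintype.card β) ≤ n) (hε : 0 ≤ ε) (hd : 1 ≤ d)
    (hK : ∀ R' ⊆ R, BipartiteDiamLE (R' : Set (α × β)) d → (R'.card : ℝ) ≤ K) :
    (s : ℝ) ^ 2 * R.card ≤ ε * (n : ℝ) ^ 2 + lowDiamNumber n ε d * ((s : ℝ) ^ 2 * K) := by
  obtain ⟨G, hG, hF⟩ := exists_bipartite_blowup R hn
  have h := ncard_edgeSet_le_lowDiamNumber hε hd G (K := (s : ℝ) ^ 2 * K) ?_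
  · rw [hG] at h
    exact_mod_cast h
  · intro F hFG hFd
    obtain ⟨R', hR', hcard, hdiam⟩ := hF F hFG
    have h1 : (F.ncard : ℝ) ≤ (s : ℝ) ^ 2 * R'.card := by exact_mod_cast hcard
    exact h1.trans (mul_le_mul_of_nonneg_left (hK R' hR' (hdiam d hFd)) (by positivity))

/-! ### Lower bound for diameter four -/

/-- The graph consists of `K` disjoint complete bipartite graphs with sides of size `s`, about `8 ε
n`. A connected part lies in one of them, and the exceptional set holds at most half of all edges,
so at least `K / 2` parts are needed. -/
theorem le_lowDiamNumber_four {n : ℕ} {ε : ℝ} (hn : 1 ≤ n) (hε : 1 / (n : ℝ) ≤ ε)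
    (h : ε * (n : ℝ) ^ 2 < (n.choose 2 : ℝ)) :
    1 / 100 / ε ≤ (lowDiamNumber n ε 4 : ℝ) := by
  have hn' : (0 : ℝ) < n := by exact_mod_cast hn
  have hε0 : 0 < ε := lt_of_lt_of_le (by positivity) hε
  by_cases hbig : 1 / 100 ≤ ε
  · refine le_trans ?_ (one_le_lowDiamNumber hε0.le (by norm_num) h)
    rwa [div_le_one hε0]
  push Not at hbig
  have hεn : 1 ≤ ε * n := by rwa [div_le_iff₀ hn'] at hε
  set s := ⌈8 * (ε * n)⌉₊ with hs
  have hs1 : 8 * (ε * n) ≤ s := Nat.le_ceil _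
  have hs2 : (s : ℝ) ≤ 9 * (ε * n) := by
    have := Nat.ceil_lt_add_one (a := 8 * (ε * n)) (by positivity)
    linarith
  have hs0 : (0 : ℝ) < s := by linarith
  have hs0' : 0 < s := by exact_mod_cast hs0
  set K := n / (2 * s) with hK
  have hKn : s * (Fintype.card (Fin K) + Fintype.card (Fin K)) ≤ n := by
    rw [Fintype.card_fin]
    calc s * (K + K) = n / (2 * s) * (2 * s) := by rw [hK]; ring
      _ ≤ n := Nat.div_mul_le_self _ _
  have hlow := card_le_lowDiamNumber_of_bipartite
    (Finset.univ.filter fun x : Fin K × Fin K => x.1 = x.2) (d := 4) (K := 1) hKn hε0.le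
    (by norm_num) ?_
  swap
  · intro R' hR' hd
    have hdiag : (R' : Set (Fin K × Fin K)) ⊆ Set.diagonal (Fin K) := fun x hx =>
      (Finset.mem_filter.1 (hR' hx)).2
    have : R'.card ≤ 1 := Finset.card_le_one.2 fun x hx y hy =>
      hd.eq_of_subset_diagonal hdiag hx hy
    exact_mod_cast this
  have hdiagcard : (Finset.univ.filter fun x : Fin K × Fin K => x.1 = x.2).card = K := by
    have : (Finset.univ.filter fun x : Fin K × Fin K => x.1 = x.2) =
        Finset.univ.image fun a : Fin K => (a, a) := by
      ext ⟨a, b⟩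
      simp
    rw [this, Finset.card_image_of_injective _ fun a b hab => (Prod.ext_iff.1 hab).1]
    simp
  rw [hdiagcard] at hlow
  -- As `s ≤ 9 ε n` and `ε < 1 / 100`, we have `2 s ≤ n / 2`: rounding in `K` costs at most a factor
  -- of two.
  have hKlow : (n : ℝ) ≤ 4 * s * K := by
    have h1 : n < 2 * s * (K + 1) := by
      rw [hK]; exact Nat.lt_mul_div_succ n (by omega)
    have h2 : (n : ℝ) < 2 * s * (K + 1) := by exact_mod_cast h1
    nlinarith
  set P : ℝ := (lowDiamNumber n ε 4 : ℝ)
  have h3 : ε * (n : ℝ) ^ 2 ≤ (s : ℝ) ^ 2 * K / 2 := by nlinarith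
  have h4 : (s : ℝ) ^ 2 * (K / 2) ≤ (s : ℝ) ^ 2 * P := by linarith
  have h5 : (K : ℝ) / 2 ≤ P := le_of_mul_le_mul_left h4 (by positivity)
  rw [div_le_iff₀ hε0]
  have h6 : (n : ℝ) ≤ 4 * (9 * (ε * n)) * K := hKlow.trans (by gcongr)
  have h7 : 1 ≤ 36 * ε * K := by
    have : 1 * (n : ℝ) ≤ (36 * ε * K) * n := by linarith
    exact le_of_mul_le_mul_right this hn'
  nlinarith

/-! ### Lower bound for diameter three: closed configurations of points and lines -/

/-- A set in the affine plane over `ZMod p` that contains the fourth vertex of every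
non-degenerate parallelogram with three vertices in the set is contained in a line, or is the whole
plane. -/
theorem eq_univ_of_parallelogram_closed {p : ℕ} [Fact p.Prime] {S : Set (ZMod p × ZMod p)}
    (hS : ∀ P ∈ S, ∀ Q ∈ S, ∀ R ∈ S,
      (Q - P).1 * (R - P).2 - (Q - P).2 * (R - P).1 ≠ 0 → Q + R - P ∈ S)
    {P Q R : ZMod p × ZMod p} (hP : P ∈ S) (hQ : Q ∈ S) (hR : R ∈ S)
    (hdet : (Q - P).1 * (R - P).2 - (Q - P).2 * (R - P).1 ≠ 0) : S = Set.univ := by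
  -- Collinear triples give nothing, so `A + 2u` is obtained as the fourth vertex over `A + v`, `A +
  -- u`, `A + u + v`.
  have hdouble : ∀ A u v : ZMod p × ZMod p, u.1 * v.2 - u.2 * v.1 ≠ 0 → A ∈ S → A + u ∈ S →
      A + v ∈ S → A + u + v ∈ S → A + u + u ∈ S ∧ A + u + u + v ∈ S := by
    intro A u v huv h0 hu hv huv'
    have h1 : A + u + u ∈ S := by
      have := hS _ hv _ hu _ huv' (by
        simp only [Prod.fst_sub, Prod.snd_sub, Prod.fst_add, Prod.snd_add]
        intro h
        apply huv
        linear_combination h)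
      convert this using 1
      abel
    refine ⟨h1, ?_⟩
    have := hS _ hu _ huv' _ h1 (by
        simp only [Prod.fst_sub, Prod.snd_sub, Prod.fst_add, Prod.snd_add]
        intro h
        apply huv
        linear_combination -h)
    convert this using 1
    abel
  have hrow : ∀ (i : ℕ) (A u v : ZMod p × ZMod p), u.1 * v.2 - u.2 * v.1 ≠ 0 → A ∈ S → A + u ∈ S →
      A + v ∈ S → A + u + v ∈ S → A + i • u ∈ S ∧ A + i • u + u ∈ S ∧ A + i • u + v ∈ S ∧
        A + i • u + u + v ∈ S := by
    intro i
    induction i with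
    | zero => intro A u v _ h0 hu hv huv'; simpa using ⟨h0, hu, hv, huv'⟩
    | succ i ih =>
      intro A u v huv h0 hu hv huv'
      obtain ⟨h1, h2, h3, h4⟩ := ih A u v huv h0 hu hv huv'
      obtain ⟨h5, h6⟩ := hdouble _ u v huv h1 h2 h3 h4
      rw [succ_nsmul, ← add_assoc]
      exact ⟨h2, h5, h4, h6⟩
  set u := Q - P with hu
  set v := R - P with hv
  rw [Set.eq_univ_iff_forall]
  intro W
  set D := u.1 * v.2 - u.2 * v.1 with hD
  -- Coordinates of `W - P` in the basis `u, v` by Cramer's rule. Over a prime field they are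
  -- natural multiples of 1, so repeated translation reaches `W`.
  set i : ZMod p := ((W - P).1 * v.2 - (W - P).2 * v.1) / D with hi
  set k : ZMod p := (u.1 * (W - P).2 - u.2 * (W - P).1) / D with hk
  have hQ' : P + u ∈ S := by rw [hu]; simpa using hQ
  have hR' : P + v ∈ S := by rw [hv]; simpa using hR
  have hQR : P + u + v ∈ S := by
    have := hS P hP Q hQ R hR hdet
    convert this using 1
    rw [hu, hv]
    abel
  obtain ⟨h1, h2, h3, h4⟩ := hrow i.val P u v hdet hP hQ' hR' hQR
  have hdet' : v.1 * u.2 - v.2 * u.1 ≠ 0 := by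
    intro h
    apply hdet
    linear_combination -h
  obtain ⟨h5, -⟩ := hrow k.val (P + i.val • u) v u hdet' h1 h3 h2 (by
    convert h4 using 1
    abel)
  convert h5 using 1
  have hi' : i * D = (W - P).1 * v.2 - (W - P).2 * v.1 := div_mul_cancel₀ _ hdet
  have hk' : k * D = u.1 * (W - P).2 - u.2 * (W - P).1 := div_mul_cancel₀ _ hdet
  have hWP : W - P = i • u + k • v := by
    ext
    · apply mul_right_cancel₀ hdet
      simp only [Prod.fst_add, Prod.smul_fst, smul_eq_mul]
      rw [add_mul, mul_right_comm, mul_right_comm k, hi', hk', hD]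
      ring
    · apply mul_right_cancel₀ hdet
      simp only [Prod.snd_add, Prod.smul_snd, smul_eq_mul]
      rw [add_mul, mul_right_comm, mul_right_comm k, hi', hk', hD]
      ring
  have hcast : ∀ (t : ZMod p) (x : ZMod p × ZMod p), t.val • x = t • x := by
    intro t x
    ext <;> simp
  rw [hcast, hcast, add_assoc, ← hWP]
  abel

/-- The point `a` lies on the line with slope `b.1` through `(0, b.2)`. -/
def OnLine {K : Type*} [CommRing K] (a b : K × K) : Prop := a.2 = b.1 * a.1 + b.2

/-- Two points lie on at most one common line: the four equations combine to (difference of slopes)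
× (difference of abscissas) = 0. -/
theorem OnLine.eq_or_eq {K : Type*} [Field K] {a a' b b' : K × K} (h1 : OnLine a b)
    (h2 : OnLine a b') (h3 : OnLine a' b) (h4 : OnLine a' b') : a = a' ∨ b = b' := by
  unfold OnLine at *
  have h : (b.1 - b'.1) * (a.1 - a'.1) = 0 := by linear_combination -h1 + h2 + h3 - h4
  rcases mul_eq_zero.1 h with h | h
  · right
    have hb : b.1 = b'.1 := sub_eq_zero.1 h
    refine Prod.ext hb ?_
    rw [hb] at h1
    linear_combination h2 - h1
  · left
    have ha : a.1 = a'.1 := sub_eq_zero.1 h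
    refine Prod.ext ha ?_
    rw [h1, h3, ha]

/-- A set of points and a set of lines such that any two of the points are joined by one of
the lines and any two of the lines meet in one of the points. -/
structure IsClosedConfiguration {K : Type*} [CommRing K] (A B : Set (K × K)) : Prop where
  join : ∀ a ∈ A, ∀ a' ∈ A, ∃ b ∈ B, OnLine a b ∧ OnLine a' b
  meet : ∀ b ∈ B, ∀ b' ∈ B, ∃ a ∈ A, OnLine a b ∧ OnLine a b'

/-- Points of a closed configuration that are off one of its lines are collinear. -/
theorem IsClosedConfiguration.collinear_off_line {p : ℕ} [Fact p.Prime]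
    {A B : Set (ZMod p × ZMod p)} (h : IsClosedConfiguration A B) {b₀ : ZMod p × ZMod p}
    (hb₀ : b₀ ∈ B) {x y z : ZMod p × ZMod p} (hx : x ∈ A) (hy : y ∈ A) (hz : z ∈ A)
    (hxb : ¬ OnLine x b₀) (hyb : ¬ OnLine y b₀) (hzb : ¬ OnLine z b₀) :
    ∃ b ∈ B, OnLine x b ∧ OnLine y b ∧ OnLine z b := by
  -- A projective transformation that moves the line `b₀` to infinity.
  let l : ZMod p × ZMod p → ZMod p := fun a => a.2 - b₀.1 * a.1 - b₀.2
  let ψ : ZMod p × ZMod p → ZMod p × ZMod p := fun a => (a.1 / l a, 1 / l a)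
  have hl : ∀ {a}, ¬ OnLine a b₀ → l a ≠ 0 := by
    intro a ha h0
    apply ha
    change a.2 - b₀.1 * a.1 - b₀.2 = 0 at h0
    unfold OnLine
    linear_combination h0
  have hline : ∀ {a b}, ¬ OnLine a b₀ →
      (OnLine a b ↔ 1 + (b₀.1 - b.1) * (ψ a).1 + (b₀.2 - b.2) * (ψ a).2 = 0) := by
    intro a b ha
    have h0 := hl ha
    have h1 : 1 + (b₀.1 - b.1) * (ψ a).1 + (b₀.2 - b.2) * (ψ a).2 =
        (a.2 - b.1 * a.1 - b.2) / l a := by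
      simp only [ψ]
      field_simp
      simp only [l]
      ring
    rw [h1, div_eq_zero_iff, or_iff_left h0]
    unfold OnLine
    constructor <;> intro h' <;> linear_combination h'
  -- The lines through a point `c` of `b₀` are mapped to parallel lines of direction `(c.1, 1)`.
  have hdir : ∀ {c b a a'}, OnLine c b₀ → OnLine c b → ¬ OnLine a b₀ → ¬ OnLine a' b₀ →
      OnLine a b → OnLine a' b → (ψ a).1 - c.1 * (ψ a).2 = (ψ a').1 - c.1 * (ψ a').2 := by
    intro c b a a' hc hc' ha ha' hab hab'
    rw [hline ha] at hab
    rw [hline ha'] at hab'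
    unfold OnLine at hc hc'
    have h1 : b₀.2 - b.2 = -(b₀.1 - b.1) * c.1 := by linear_combination hc' - hc
    rw [h1] at hab hab'
    have h2 : b₀.1 - b.1 ≠ 0 := by
      intro h2
      rw [h2] at hab
      simp at hab
    apply mul_left_cancel₀ h2
    linear_combination hab - hab'
  set S : Set (ZMod p × ZMod p) := ψ '' {a | a ∈ A ∧ ¬ OnLine a b₀} with hSdef
  -- The lines `PQ` and `PR` meet `b₀` in `c₁` and `c₂`. The lines `R c₁` and `Q c₂` become
  -- parallels to them, so their intersection `T` is mapped to the fourth vertex.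
  have hS : ∀ P ∈ S, ∀ Q ∈ S, ∀ R ∈ S,
      (Q - P).1 * (R - P).2 - (Q - P).2 * (R - P).1 ≠ 0 → Q + R - P ∈ S := by
    rintro _ ⟨P, ⟨hP, hP0⟩, rfl⟩ _ ⟨Q, ⟨hQ, hQ0⟩, rfl⟩ _ ⟨R, ⟨hR, hR0⟩, rfl⟩ hdet
    obtain ⟨b₁, hb₁, hPb₁, hQb₁⟩ := h.join P hP Q hQ
    obtain ⟨b₂, hb₂, hPb₂, hRb₂⟩ := h.join P hP R hR
    obtain ⟨c₁, hc₁, hc₁0, hc₁b⟩ := h.meet b₀ hb₀ b₁ hb₁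
    obtain ⟨c₂, hc₂, hc₂0, hc₂b⟩ := h.meet b₀ hb₀ b₂ hb₂
    have e1 := hdir hc₁0 hc₁b hP0 hQ0 hPb₁ hQb₁
    have e2 := hdir hc₂0 hc₂b hP0 hR0 hPb₂ hRb₂
    have hne : c₁.1 ≠ c₂.1 := by
      intro heq
      apply hdet
      rw [← heq] at e2
      simp only [Prod.fst_sub, Prod.snd_sub]
      linear_combination ((ψ P).2 - (ψ R).2) * e1 + ((ψ Q).2 - (ψ P).2) * e2
    obtain ⟨b₃, hb₃, hRb₃, hc₁b₃⟩ := h.join R hR c₁ hc₁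
    obtain ⟨b₄, hb₄, hQb₄, hc₂b₄⟩ := h.join Q hQ c₂ hc₂
    obtain ⟨T, hT, hTb₃, hTb₄⟩ := h.meet b₃ hb₃ b₄ hb₄
    have hT0 : ¬ OnLine T b₀ := by
      intro hT0
      have f1 : T = c₁ := (hT0.eq_or_eq hTb₃ hc₁0 hc₁b₃).resolve_right
        fun heq => hR0 (heq ▸ hRb₃)
      have f2 : T = c₂ := (hT0.eq_or_eq hTb₄ hc₂0 hc₂b₄).resolve_right
        fun heq => hQ0 (heq ▸ hQb₄)
      exact hne (congrArg Prod.fst (f1.symm.trans f2))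
    have e3 := hdir hc₁0 hc₁b₃ hT0 hR0 hTb₃ hRb₃
    have e4 := hdir hc₂0 hc₂b₄ hT0 hQ0 hTb₄ hQb₄
    refine ⟨T, ⟨hT, hT0⟩, ?_⟩
    have hne' : c₁.1 - c₂.1 ≠ 0 := sub_ne_zero.2 hne
    have g2 : (ψ T).2 = (ψ Q).2 + (ψ R).2 - (ψ P).2 := by
      apply mul_left_cancel₀ hne'
      linear_combination e4 - e3 - e1 + e2
    refine Prod.ext ?_ g2
    simp only [Prod.fst_sub, Prod.fst_add]
    linear_combination e3 + e1 + c₁.1 * g2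
  -- Second coordinates of `ψ` off `b₀` are inverses, hence nonzero. So `S` is not the whole plane
  -- and must be collinear.
  have hSne : S ≠ Set.univ := by
    intro hSu
    have : ((0, 0) : ZMod p × ZMod p) ∈ S := hSu ▸ Set.mem_univ _
    obtain ⟨a, ⟨_, ha⟩, ha'⟩ := this
    have h2 : 1 / l a = 0 := congrArg Prod.snd ha'
    exact hl ha (by simpa using h2)
  by_cases hxy : x = y
  · obtain ⟨b, hb, h1, h2⟩ := h.join x hx z hz
    exact ⟨b, hb, h1, hxy ▸ h1, h2⟩
  obtain ⟨b, hb, hxb', hyb'⟩ := h.join x hx y hy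
  refine ⟨b, hb, hxb', hyb', ?_⟩
  have hdet : (ψ y - ψ x).1 * (ψ z - ψ x).2 - (ψ y - ψ x).2 * (ψ z - ψ x).1 = 0 := by
    by_contra hdet
    exact hSne (eq_univ_of_parallelogram_closed hS ⟨x, ⟨hx, hxb⟩, rfl⟩ ⟨y, ⟨hy, hyb⟩, rfl⟩
      ⟨z, ⟨hz, hzb⟩, rfl⟩ hdet)
  obtain ⟨c, hc, hc0, hcb⟩ := h.meet b₀ hb₀ b hb
  have e := hdir hc0 hcb hxb hyb hxb' hyb'
  simp only [Prod.fst_sub, Prod.snd_sub] at hdet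
  -- The images differ by a multiple of `(c.1, 1)`, and `ψ` is injective off `b₀`.
  have hne : (ψ y).2 - (ψ x).2 ≠ 0 := by
    intro h0
    have h2 : (ψ x).2 = (ψ y).2 := (sub_eq_zero.1 h0).symm
    rw [h2] at e
    have h1 : (ψ x).1 = (ψ y).1 := by linear_combination e
    have hlx := hl hxb
    have hly := hl hyb
    have hll : l x = l y := by
      have : 1 / l x = 1 / l y := h2
      simpa using this
    have hx1 : x.1 = y.1 := by
      have : x.1 / l x = y.1 / l y := h1
      rw [hll] at this
      exact (div_left_inj' hly).1 this
    apply hxy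
    refine Prod.ext hx1 ?_
    have hll' : x.2 - b₀.1 * x.1 - b₀.2 = y.2 - b₀.1 * y.1 - b₀.2 := hll
    rw [hx1] at hll'
    linear_combination hll'
  have e' : (ψ z).1 - c.1 * (ψ z).2 = (ψ x).1 - c.1 * (ψ x).2 := by
    apply mul_left_cancel₀ hne
    linear_combination -hdet + ((ψ x).2 - (ψ z).2) * e
  rw [hline hxb] at hxb'
  rw [hline hzb]
  unfold OnLine at hc0 hcb
  have h1 : b₀.2 - b.2 = -(b₀.1 - b.1) * c.1 := by linear_combination hcb - hc0
  rw [h1] at hxb' ⊢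
  linear_combination hxb' + (b₀.1 - b.1) * e'

section Incidences

open Classical

theorem card_filter_onLine_le {p : ℕ} [Fact p.Prime] (A : Finset (ZMod p × ZMod p))
    (b : ZMod p × ZMod p) : (A.filter fun a => OnLine a b).card ≤ p := by
  have h := Finset.card_le_card_of_injOn (s := A.filter fun a => OnLine a b)
    (t := (Finset.univ : Finset (ZMod p))) Prod.fst (fun _ _ => Finset.mem_coe.2 (Finset.mem_univ _))
    (by
      intro a ha a' ha' h
      have h1 : OnLine a b := (Finset.mem_filter.1 ha).2
      have h2 : OnLine a' b := (Finset.mem_filter.1 ha').2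
      unfold OnLine at h1 h2
      exact Prod.ext h (by rw [h1, h2, h]))
  simpa [ZMod.card] using h

theorem card_filter_lines_le {p : ℕ} [Fact p.Prime] (B : Finset (ZMod p × ZMod p))
    (a : ZMod p × ZMod p) : (B.filter fun b => OnLine a b).card ≤ p := by
  have h := Finset.card_le_card_of_injOn (s := B.filter fun b => OnLine a b)
    (t := (Finset.univ : Finset (ZMod p))) Prod.fst (fun _ _ => Finset.mem_coe.2 (Finset.mem_univ _))
    (by
      intro b hb b' hb' h
      have h1 : OnLine a b := (Finset.mem_filter.1 hb).2
      have h2 : OnLine a b' := (Finset.mem_filter.1 hb').2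
      unfold OnLine at h1 h2
      have h : b.1 = b'.1 := h
      refine Prod.ext h ?_
      rw [h] at h1
      linear_combination h2 - h1)
  simpa [ZMod.card] using h

/-- Distinct lines share at most one point, so among three points of `b` two are off `b'`. -/
theorem exists_ne_not_onLine {K : Type*} [Field K] {A : Finset (K × K)} {b b' : K × K}
    (hcard : 2 < (A.filter fun a => OnLine a b).card) (hb : b ≠ b') :
    ∃ x ∈ A, ∃ y ∈ A, x ≠ y ∧ OnLine x b ∧ OnLine y b ∧ ¬ OnLine x b' ∧ ¬ OnLine y b' := by
  obtain ⟨x, hx, y, hy, z, hz, hxy, hxz, hyz⟩ := Finset.two_lt_card.1 hcard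
  rw [Finset.mem_filter] at hx hy hz
  have key : ∀ {u v}, OnLine u b → OnLine v b → u ≠ v → OnLine u b' → ¬ OnLine v b' :=
    fun hu hv huv hu' hv' => (hu.eq_or_eq hu' hv hv').elim huv hb
  by_cases h1 : OnLine x b'
  · exact ⟨y, hy.1, z, hz.1, hyz, hy.2, hz.2, key hx.2 hy.2 hxy h1, key hx.2 hz.2 hxz h1⟩
  · by_cases h2 : OnLine y b'
    · exact ⟨x, hx.1, z, hz.1, hxz, hx.2, hz.2, h1, key hy.2 hz.2 hyz h2⟩
    · exact ⟨x, hx.1, y, hy.1, hxy, hx.2, hy.2, h1, h2⟩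

/-- Two distinct points off `b` determine `b'`, and any further point off `b` lies on it by
`collinear_off_line`. With at most one point off `b` the choice is immediate. -/
theorem IsClosedConfiguration.exists_cover {p : ℕ} [Fact p.Prime]
    {A B : Set (ZMod p × ZMod p)} (h : IsClosedConfiguration A B) {b : ZMod p × ZMod p}
    (hb : b ∈ B) : ∃ b' ∈ B, ∀ a ∈ A, OnLine a b ∨ OnLine a b' := by
  by_cases hx : ∃ x ∈ A, ¬ OnLine x b
  · obtain ⟨x, hx, hxb⟩ := hx
    by_cases hy : ∃ y ∈ A, y ≠ x ∧ ¬ OnLine y b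
    · obtain ⟨y, hy, hyx, hyb⟩ := hy
      obtain ⟨b', hb', hxb', hyb'⟩ := h.join x hx y hy
      refine ⟨b', hb', fun z hz => or_iff_not_imp_left.2 fun hzb => ?_⟩
      obtain ⟨b'', -, h1, h2, h3⟩ := h.collinear_off_line hb hx hy hz hxb hyb hzb
      have : b' = b'' := (hxb'.eq_or_eq h1 hyb' h2).resolve_left (Ne.symm hyx)
      exact this ▸ h3
    · push Not at hy
      obtain ⟨b', hb', hxb', -⟩ := h.join x hx x hx
      refine ⟨b', hb', fun z hz => or_iff_not_imp_left.2 fun hzb => ?_⟩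
      have : z = x := by
        by_contra hne
        exact hzb (hy z hz hne)
      exact this ▸ hxb'
  · push Not at hx
    exact ⟨b, hb, fun a ha => .inl (hx a ha)⟩

/-- A closed configuration in the affine plane over `ZMod p` has at most `5 p` incidences. -/
theorem IsClosedConfiguration.card_incidences_le {p : ℕ} [Fact p.Prime]
    {A B : Finset (ZMod p × ZMod p)}
    (h : IsClosedConfiguration (A : Set (ZMod p × ZMod p)) (B : Set (ZMod p × ZMod p))) :
    ((A ×ˢ B).filter fun x => OnLine x.1 x.2).card ≤ 5 * p := by
  have hI : ((A ×ˢ B).filter fun x => OnLine x.1 x.2).card =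
      ∑ b ∈ B, (A.filter fun a => OnLine a b).card := by
    simp_rw [Finset.card_filter]
    rw [Finset.sum_product_right]
  have hI' : ((A ×ˢ B).filter fun x => OnLine x.1 x.2).card =
      ∑ a ∈ A, (B.filter fun b => OnLine a b).card := by
    simp_rw [Finset.card_filter]
    rw [Finset.sum_product]
  -- If every line has at most two points, two lines cover `A`, so there are at most 4 points, each
  -- on at most `p` lines.
  by_cases hsmall : ∀ b ∈ B, (A.filter fun a => OnLine a b).card ≤ 2
  · rcases B.eq_empty_or_nonempty with rfl | ⟨b, hb⟩
    · simp
    obtain ⟨b', hb', hcov⟩ := h.exists_cover hb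
    have hA : A.card ≤ 4 := by
      have : A ⊆ (A.filter fun a => OnLine a b) ∪ A.filter fun a => OnLine a b' := by
        intro a ha
        rcases hcov a ha with h1 | h1 <;> simp [ha, h1]
      have h1 := (Finset.card_le_card this).trans (Finset.card_union_le _ _)
      have h2 := hsmall b hb
      have h3 := hsmall b' hb'
      omega
    rw [hI']
    calc ∑ a ∈ A, (B.filter fun b => OnLine a b).card ≤ A.card • p :=
          Finset.sum_le_card_nsmul _ _ _ fun a _ => card_filter_lines_le B a
      _ ≤ 5 * p := by rw [smul_eq_mul]; exact Nat.mul_le_mul_right p (by omega)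
  push Not at hsmall
  obtain ⟨b₀, hb₀, hbig⟩ := hsmall
  -- Two points of `b₀` are off `b`, so the companion line of `b` is `b₀` itself.
  have hcov : ∀ b ∈ B, b ≠ b₀ → ∀ a ∈ A, OnLine a b ∨ OnLine a b₀ := by
    intro b hb hne
    obtain ⟨b', hb', hcov⟩ := h.exists_cover hb
    obtain ⟨x, hx, y, hy, hxy, hx0, hy0, hxb, hyb⟩ := exists_ne_not_onLine hbig hne.symm
    have : b₀ = b' := (hx0.eq_or_eq ((hcov x hx).resolve_left hxb) hy0
      ((hcov y hy).resolve_left hyb)).resolve_left hxy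
    exact this ▸ hcov
  rw [hI, ← Finset.add_sum_erase B _ hb₀]
  have h0 := card_filter_onLine_le A b₀
  -- If the other lines have at most two points each, every line passes through one of the at most
  -- two points of `b₂`; so there are at most `2 p` lines and `p + 2 * (2 p)` incidences. Otherwise
  -- some `b₂` has three points, two of them off `b₀`; these lie on every line other than `b₀`, so
  -- only `b₀` and `b₂` remain.
  by_cases hsmall : ∀ b ∈ B.erase b₀, (A.filter fun a => OnLine a b).card ≤ 2
  · rcases (B.erase b₀).eq_empty_or_nonempty with hB | ⟨b₂, hb₂⟩
    · rw [hB, Finset.sum_empty]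
      omega
    have hB : B.card ≤ 2 * p := by
      have hsub : B ⊆ (A.filter fun a => OnLine a b₂).biUnion
          fun a => B.filter fun b => OnLine a b := by
        intro b hb
        obtain ⟨a, ha, h1, h2⟩ := h.meet b₂ (Finset.mem_of_mem_erase hb₂) b hb
        exact Finset.mem_biUnion.2 ⟨a, Finset.mem_filter.2 ⟨ha, h1⟩, Finset.mem_filter.2 ⟨hb, h2⟩⟩
      refine (Finset.card_le_card hsub).trans (Finset.card_biUnion_le.trans ?_)
      refine (Finset.sum_le_card_nsmul _ _ p fun a _ => card_filter_lines_le B a).trans ?_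
      rw [smul_eq_mul]
      exact Nat.mul_le_mul_right p (hsmall b₂ hb₂)
    have h1 := Finset.sum_le_card_nsmul _ _ _ hsmall
    rw [smul_eq_mul] at h1
    have h2 : (B.erase b₀).card ≤ B.card := Finset.card_erase_le
    omega
  · push Not at hsmall
    obtain ⟨b₂, hb₂, hbig₂⟩ := hsmall
    have hB : B.erase b₀ ⊆ {b₂} := by
      intro b hb
      rw [Finset.mem_singleton]
      obtain ⟨x, hx, y, hy, hxy, hx2, hy2, hx0, hy0⟩ :=
        exists_ne_not_onLine hbig₂ (Finset.ne_of_mem_erase hb₂)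
      have hc := hcov b (Finset.mem_of_mem_erase hb) (Finset.ne_of_mem_erase hb)
      exact (((hc x hx).resolve_right hx0).eq_or_eq hx2 ((hc y hy).resolve_right hy0)
        hy2).resolve_left hxy
    have h1 := Finset.sum_le_sum_of_subset (f := fun b => (A.filter fun a => OnLine a b).card) hB
    rw [Finset.sum_singleton] at h1
    have h2 := card_filter_onLine_le A b₂
    omega

theorem card_le_of_bipartiteDiamLE_three {p : ℕ} [Fact p.Prime]
    {R : Finset ((ZMod p × ZMod p) × (ZMod p × ZMod p))} (hR : ∀ x ∈ R, OnLine x.1 x.2)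
    (h : BipartiteDiamLE (R : Set ((ZMod p × ZMod p) × (ZMod p × ZMod p))) 3) :
    R.card ≤ 5 * p := by
  have hconf : IsClosedConfiguration ((R.image Prod.fst : Finset _) : Set (ZMod p × ZMod p))
      ((R.image Prod.snd : Finset _) : Set (ZMod p × ZMod p)) := by
    constructor
    · intro a ha a' ha'
      obtain ⟨⟨_, b⟩, hx, rfl⟩ := Finset.mem_image.1 (Finset.mem_coe.1 ha)
      obtain ⟨⟨_, b'⟩, hy, rfl⟩ := Finset.mem_image.1 (Finset.mem_coe.1 ha')
      obtain ⟨c, hc, hc'⟩ := h.exists_common_right hx hy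
      exact ⟨c, Finset.mem_coe.2 (Finset.mem_image.2 ⟨_, hc, rfl⟩), hR _ hc, hR _ hc'⟩
    · intro b hb b' hb'
      obtain ⟨⟨a, _⟩, hx, rfl⟩ := Finset.mem_image.1 (Finset.mem_coe.1 hb)
      obtain ⟨⟨a', _⟩, hy, rfl⟩ := Finset.mem_image.1 (Finset.mem_coe.1 hb')
      obtain ⟨c, hc, hc'⟩ := h.exists_common_left hx hy
      exact ⟨c, Finset.mem_coe.2 (Finset.mem_image.2 ⟨_, hc, rfl⟩), hR _ hc, hR _ hc'⟩
  refine (Finset.card_le_card ?_).trans hconf.card_incidences_le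
  intro x hx
  exact Finset.mem_filter.2 ⟨Finset.mem_product.2 ⟨Finset.mem_image_of_mem _ hx,
    Finset.mem_image_of_mem _ hx⟩, hR x hx⟩

theorem card_incidences_univ (p : ℕ) [Fact p.Prime] :
    (Finset.univ.filter fun x : (ZMod p × ZMod p) × (ZMod p × ZMod p) =>
      OnLine x.1 x.2).card = p ^ 3 := by
  have : (Finset.univ.filter fun x : (ZMod p × ZMod p) × (ZMod p × ZMod p) => OnLine x.1 x.2) =
      Finset.univ.image fun y : ZMod p × (ZMod p × ZMod p) =>
        ((y.1, y.2.1 * y.1 + y.2.2), y.2) := by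
    ext ⟨⟨a, a'⟩, b⟩
    rw [Finset.mem_filter]
    simp [OnLine, Prod.ext_iff, eq_comm]
  rw [this, Finset.card_image_of_injective]
  · simp only [Finset.card_univ, Fintype.card_prod, ZMod.card]
    ring
  · rintro ⟨y, z⟩ ⟨y', z'⟩ h
    simp only [Prod.mk.injEq] at h
    exact Prod.ext h.1.1 h.2

theorem le_lowDiamNumber_three {n : ℕ} {ε : ℝ} (hn : 1 ≤ n) (hε : 1 / √(n : ℝ) ≤ ε)
    (h : ε * (n : ℝ) ^ 2 < (n.choose 2 : ℝ)) :
    1 / 40960 / ε ^ 2 ≤ (lowDiamNumber n ε 3 : ℝ) := by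
  have hn' : (0 : ℝ) < n := by exact_mod_cast hn
  have hsq : 0 < √(n : ℝ) := Real.sqrt_pos.2 hn'
  have hε0 : 0 < ε := lt_of_lt_of_le (by positivity) hε
  by_cases hbig : 1 / 64 < ε
  · refine le_trans ?_ (one_le_lowDiamNumber hε0.le (by norm_num) h)
    rw [div_le_one (by positivity)]
    nlinarith
  push Not at hbig
  have hεn : 1 ≤ ε ^ 2 * n := by
    rw [div_le_iff₀ hsq] at hε
    have := one_le_pow₀ hε (n := 2)
    rwa [mul_pow, Real.sq_sqrt hn'.le] at this
  -- Bertrand's postulate gives a prime with `1 / 64 < ε p ≤ 1 / 32`: small enough for the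
  -- exceptional set to hold at most half of the `s ^ 2 p ^ 3` edges, large enough for `p ^ 2 / 10`
  -- to be of order `1 / ε ^ 2`.
  set N := ⌊1 / (64 * ε)⌋₊ with hN
  have hN1 : 1 ≤ N := by
    refine Nat.le_floor ?_
    rw [Nat.cast_one, le_div_iff₀ (by positivity)]
    linarith
  obtain ⟨p, hp, hNp, hpN⟩ := Nat.exists_prime_lt_and_le_two_mul N (by omega)
  have : Fact p.Prime := ⟨hp⟩
  have hp0 : (0 : ℝ) < p := by exact_mod_cast hp.pos
  have hlow : 1 < 64 * (ε * p) := by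
    have h1 : 1 / (64 * ε) < p := by
      refine (Nat.lt_floor_add_one _).trans_le ?_
      exact_mod_cast hNp
    rw [div_lt_iff₀ (by positivity)] at h1
    linarith
  have hup : 32 * (ε * p) ≤ 1 := by
    have h1 : (N : ℝ) ≤ 1 / (64 * ε) := Nat.floor_le (by positivity)
    have h2 : (p : ℝ) ≤ 2 * N := by exact_mod_cast hpN
    rw [le_div_iff₀ (by positivity)] at h1
    nlinarith
  -- The bound `ε ≥ 1 / √n` makes room for all `2 p ^ 2` points and lines, so that `s ≥ 1`.
  have hpn : 2 * p ^ 2 ≤ n := by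
    have h1 : (ε * p) ^ 2 ≤ (1 / 32) ^ 2 := pow_le_pow_left₀ (by positivity) (by linarith) 2
    have h2 : ε ^ 2 * (2 * p ^ 2) ≤ ε ^ 2 * n := by
      rw [mul_pow] at h1
      linarith
    have h3 : (2 * p ^ 2 : ℝ) ≤ n := le_of_mul_le_mul_left h2 (by positivity)
    exact_mod_cast h3
  set s := n / (2 * p ^ 2) with hs
  have hp2 : 0 < 2 * p ^ 2 := by have := hp.pos; positivity
  have hs1 : 1 ≤ s := (Nat.one_le_div_iff hp2).2 hpn
  have hs1' : (1 : ℝ) ≤ s := by exact_mod_cast hs1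
  have hns : (n : ℝ) ≤ 4 * p ^ 2 * s := by
    have h1 : n < 2 * p ^ 2 * (s + 1) := Nat.lt_mul_div_succ n hp2
    have h2 : (n : ℝ) < 2 * p ^ 2 * (s + 1) := by exact_mod_cast h1
    nlinarith [sq_nonneg (p : ℝ)]
  have hcard : s * (Fintype.card (ZMod p × ZMod p) + Fintype.card (ZMod p × ZMod p)) ≤ n := by
    rw [Fintype.card_prod, ZMod.card]
    calc s * (p * p + p * p) = n / (2 * p ^ 2) * (2 * p ^ 2) := by rw [hs]; ring
      _ ≤ n := Nat.div_mul_le_self _ _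
  have hmain := card_le_lowDiamNumber_of_bipartite
    (Finset.univ.filter fun x : (ZMod p × ZMod p) × (ZMod p × ZMod p) => OnLine x.1 x.2)
    (d := 3) (K := 5 * p) hcard hε0.le (by norm_num) (by
      intro R' hR' hd
      exact_mod_cast card_le_of_bipartiteDiamLE_three
        (fun x hx => (Finset.mem_filter.1 (hR' hx)).2) hd)
  rw [card_incidences_univ] at hmain
  push_cast at hmain
  set P : ℝ := (lowDiamNumber n ε 3 : ℝ)
  have h1 : ε * (n : ℝ) ^ 2 ≤ (s : ℝ) ^ 2 * (p ^ 3 / 2) := by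
    calc ε * (n : ℝ) ^ 2 ≤ ε * (4 * p ^ 2 * s) ^ 2 := by gcongr
      _ = 16 * (ε * p) * (p ^ 3 * s ^ 2) := by ring
      _ ≤ 1 / 2 * (p ^ 3 * s ^ 2) := by gcongr; linarith
      _ = _ := by ring
  have h2 : ((s : ℝ) ^ 2 * p) * (p ^ 2 / 10) ≤ ((s : ℝ) ^ 2 * p) * P := by
    nlinarith
  have h3 : (p : ℝ) ^ 2 / 10 ≤ P := le_of_mul_le_mul_left h2 (by positivity)
  rw [div_le_iff₀ (by positivity)]
  have h4 : 1 ≤ (64 * (ε * p)) ^ 2 := one_le_pow₀ hlow.le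
  have h5 : (p : ℝ) ^ 2 / 10 * ε ^ 2 ≤ P * ε ^ 2 := by gcongr
  nlinarith

end Incidences

/-! ### Lower bound for diameter two: random relations -/

theorem card_functions_avoiding {X Y : Type*} [Fintype X] [DecidableEq X] [Fintype Y]
    [DecidableEq Y] (z : Y) (S : Finset X) :
    ((Finset.univ.filter fun f : X → Y => ∀ x ∈ S, f x ≠ z).card : ℝ) =
      (Fintype.card Y : ℝ) ^ Fintype.card X * (1 - 1 / (Fintype.card Y : ℝ)) ^ S.card := by
  have hq : (0 : ℝ) < Fintype.card Y := by exact_mod_cast Fintype.card_pos_iff.2 ⟨z⟩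
  have h1 : (Finset.univ.filter fun f : X → Y => ∀ x ∈ S, f x ≠ z) =
      Fintype.piFinset fun x => if x ∈ S then Finset.univ.erase z else Finset.univ := by
    ext f
    simp only [Finset.mem_filter, Finset.mem_univ, true_and, Fintype.mem_piFinset]
    refine forall_congr' fun x => ?_
    by_cases hx : x ∈ S <;> simp [hx]
  rw [h1, Fintype.card_piFinset, Nat.cast_prod]
  have h2 : ∀ x : X, (((if x ∈ S then Finset.univ.erase z else Finset.univ : Finset Y).card : ℕ) : ℝ)
      = Fintype.card Y * if x ∈ S then 1 - 1 / (Fintype.card Y : ℝ) else 1 := by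
    intro x
    by_cases hx : x ∈ S
    · simp only [hx, if_true]
      rw [Finset.card_erase_of_mem (Finset.mem_univ z), Finset.card_univ,
        Nat.cast_sub (by exact_mod_cast hq), Nat.cast_one]
      field_simp
    · simp [hx]
  simp_rw [h2]
  rw [Finset.prod_mul_distrib, Finset.prod_const, Finset.card_univ, Finset.prod_ite_mem,
    Finset.univ_inter, Finset.prod_const]

/-- A relation of density almost one without large complete bipartite subgraphs. -/
theorem exists_dense_relation_without_large_rectangles (α β : Type*) [Fintype α] [Fintype β]
    [DecidableEq α] [DecidableEq β] {q : ℕ} (hq : 0 < q) :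
    ∃ R : Finset (α × β),
      (q : ℝ) * (Fintype.card α * Fintype.card β) ≤
        q * R.card + 2 * (Fintype.card α * Fintype.card β) ∧
      ∀ (A : Finset α) (B : Finset β), A ×ˢ B ⊆ R →
        A.card * B.card ≤ q * (Fintype.card α + Fintype.card β + 2) := by
  rcases Nat.eq_zero_or_pos (Fintype.card α * Fintype.card β) with h0 | hpos
  · refine ⟨∅, ?_, ?_⟩
    · have : (Fintype.card α * Fintype.card β : ℝ) = 0 := by exact_mod_cast h0
      simp [this]
    · intro A B hAB
      rw [← Finset.card_product, Finset.subset_empty.1 hAB]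
      simp
  set N : ℝ := (Fintype.card α * Fintype.card β : ℝ) with hN
  have hN0 : 0 < N := by rw [hN]; exact_mod_cast hpos
  have hq0 : (0 : ℝ) < q := by exact_mod_cast hq
  set T := q * (Fintype.card α + Fintype.card β + 2) with hT
  let z : Fin q := ⟨0, hq⟩
  -- A uniformly random `f` deletes each pair independently with probability `1 / q`; `bad f`
  -- collects the oversized rectangles that survive.
  let R : (α × β → Fin q) → Finset (α × β) := fun f => Finset.univ.filter fun x => f x ≠ z
  let bad : (α × β → Fin q) → Finset (Finset α × Finset β) := fun f =>
    Finset.univ.filter fun D => T < D.1.card * D.2.card ∧ D.1 ×ˢ D.2 ⊆ R f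
  by_contra! hcon
  -- If no relation works, every `f` deletes more than `2 N / q` pairs or has a bad rectangle. On
  -- average `q` times the deletions is `N` and the number of bad rectangles is at most `1 / 4`,
  -- giving the contradiction `2 N ≤ 3 N / 2`.
  have hpoint : ∀ f, 2 * N ≤ q * (N - (R f).card) + 2 * N * (bad f).card := by
    intro f
    have hRN : ((R f).card : ℝ) ≤ N := by
      have := Finset.card_le_univ (R f)
      rw [Fintype.card_prod] at this
      rw [hN]
      exact_mod_cast this
    by_cases hf : (q : ℝ) * N ≤ q * (R f).card + 2 * N
    · obtain ⟨A, B, hAB, hlt⟩ := hcon (R f) hf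
      have : 0 < (bad f).card := Finset.card_pos.2
        ⟨(A, B), Finset.mem_filter.2 ⟨Finset.mem_univ _, hlt, hAB⟩⟩
      have h1 : (1 : ℝ) ≤ (bad f).card := by exact_mod_cast this
      have h2 : 0 ≤ (q : ℝ) * (N - (R f).card) := mul_nonneg hq0.le (by linarith)
      nlinarith
    · push Not at hf
      have h2 : 0 ≤ 2 * N * ((bad f).card : ℝ) := by positivity
      linarith
  set M : ℝ := (q : ℝ) ^ (Fintype.card (α × β)) with hM
  have hM0 : 0 < M := by positivity
  have hcardf : (Fintype.card (α × β → Fin q) : ℝ) = M := by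
    rw [Fintype.card_fun, Fintype.card_fin, Nat.cast_pow]
  have hsum : M * (2 * N) ≤ q * (M * N - ∑ f, ((R f).card : ℝ)) +
      2 * N * ∑ f, ((bad f).card : ℝ) := by
    have hconst : ∀ x : ℝ, ∑ _f : α × β → Fin q, x = M * x := by
      intro x
      rw [Finset.sum_const, Finset.card_univ, nsmul_eq_mul, hcardf]
    rw [← hconst N, ← Finset.sum_sub_distrib, Finset.mul_sum, Finset.mul_sum,
      ← Finset.sum_add_distrib, ← hconst]
    exact Finset.sum_le_sum fun f _ => hpoint f
  have hR : ∑ f, ((R f).card : ℝ) = N * (M * (1 - 1 / q)) := by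
    have h1 : ∀ f, ((R f).card : ℝ) = ∑ x, if f x ≠ z then (1 : ℝ) else 0 := by
      intro f
      rw [Finset.sum_boole]
    simp_rw [h1]
    rw [Finset.sum_comm]
    have h2 : ∀ x : α × β, (∑ f : α × β → Fin q, if f x ≠ z then (1 : ℝ) else 0) =
        M * (1 - 1 / q) := by
      intro x
      have := card_functions_avoiding z {x}
      simp only [Finset.mem_singleton, forall_eq, Finset.card_singleton, pow_one,
        Fintype.card_fin] at this
      rw [Finset.sum_boole, this]
    simp_rw [h2]
    rw [Finset.sum_const, Finset.card_univ, nsmul_eq_mul, Fintype.card_prod, Nat.cast_mul]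
  -- Union bound over all rectangles: one with more than `T` cells survives with probability at most
  -- `(1 - 1 / q) ^ T ≤ 2 ^ -(|α| + |β| + 2)`. The summand 2 in `T` yields `1 / 4`.
  have hbad : ∑ f, ((bad f).card : ℝ) ≤ M / 4 := by
    have h1 : ∀ f, ((bad f).card : ℝ) = ∑ D : Finset α × Finset β,
        if T < D.1.card * D.2.card ∧ D.1 ×ˢ D.2 ⊆ R f then (1 : ℝ) else 0 := by
      intro f
      rw [Finset.sum_boole]
    simp_rw [h1]
    rw [Finset.sum_comm]
    have h2 : ∀ D : Finset α × Finset β, (∑ f : α × β → Fin q,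
        if T < D.1.card * D.2.card ∧ D.1 ×ˢ D.2 ⊆ R f then (1 : ℝ) else 0) ≤
        M * (1 / 2) ^ (Fintype.card α + Fintype.card β + 2) := by
      intro D
      by_cases hD : T < D.1.card * D.2.card
      · have h3 := card_functions_avoiding z (D.1 ×ˢ D.2)
        have h4 : ∀ f : α × β → Fin q, D.1 ×ˢ D.2 ⊆ R f ↔ ∀ x ∈ D.1 ×ˢ D.2, f x ≠ z := by
          intro f
          refine forall_congr' fun x => imp_congr_right fun _ => ?_
          simp [R]
        simp only [hD, true_and, h4]
        rw [Finset.sum_boole, h3, Fintype.card_fin, Finset.card_product]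
        refine mul_le_mul_of_nonneg_left ?_ hM0.le
        have hq1 : (1 : ℝ) ≤ q := by exact_mod_cast hq
        have h5 : 0 ≤ 1 - 1 / (q : ℝ) := by
          rw [sub_nonneg, div_le_one hq0]
          exact hq1
        have h6 : 1 - 1 / (q : ℝ) ≤ 1 := by
          have : 0 < 1 / (q : ℝ) := by positivity
          linarith
        have h7 : (1 - 1 / (q : ℝ)) ^ q ≤ 1 / 2 := by
          refine (Real.one_sub_div_pow_le_exp_neg hq1).trans ?_
          have := Real.exp_neg_one_lt_d9
          linarith
        calc (1 - 1 / (q : ℝ)) ^ (D.1.card * D.2.card) ≤ (1 - 1 / (q : ℝ)) ^ T :=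
              pow_le_pow_of_le_one h5 h6 hD.le
          _ = ((1 - 1 / (q : ℝ)) ^ q) ^ (Fintype.card α + Fintype.card β + 2) := by
              rw [hT, pow_mul]
          _ ≤ _ := pow_le_pow_left₀ (pow_nonneg h5 _) h7 _
      · simp only [hD, false_and, if_false, Finset.sum_const_zero]
        positivity
    refine (Finset.sum_le_sum fun D _ => h2 D).trans (le_of_eq ?_)
    rw [Finset.sum_const, Finset.card_univ, Fintype.card_prod, Fintype.card_finset,
      Fintype.card_finset, nsmul_eq_mul, ← pow_add, pow_add _ _ 2]
    push_cast
    rw [one_div_pow]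
    field_simp
    norm_num
  rw [hR] at hsum
  have h1 : (q : ℝ) * (M * N - N * (M * (1 - 1 / q))) = N * M := by
    field_simp
    ring
  rw [h1] at hsum
  have h2 : 2 * N * ∑ f, ((bad f).card : ℝ) ≤ 2 * N * (M / 4) := by gcongr
  have h3 : 0 < N * M := by positivity
  nlinarith

theorem exists_const_mul_le_lowDiamNumber_two {δ : ℝ} (hδ : 0 < δ) :
    ∃ c : ℝ, 0 < c ∧ ∀ (n : ℕ) (ε : ℝ), 2 ≤ n → 0 ≤ ε → ε ≤ 1 / 4 - δ →
      c * (n : ℝ) ≤ (lowDiamNumber n ε 2 : ℝ) := by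
  -- With this `q` the relation misses at most a fraction `2 / q ≤ δ` of the pairs.
  set q := ⌈2 / δ⌉₊ with hqdef
  have hqδ : 2 / δ ≤ q := Nat.le_ceil _
  have hq : 0 < q := Nat.ceil_pos.2 (by positivity)
  have hq0 : (0 : ℝ) < q := by exact_mod_cast hq
  have hq1 : (1 : ℝ) ≤ q := by exact_mod_cast hq
  rw [div_le_iff₀ hδ] at hqδ
  refine ⟨δ / (4 * q), by positivity, ?_⟩
  intro n ε hn hε hεδ
  have hn' : (2 : ℝ) ≤ n := by exact_mod_cast hn
  rw [div_mul_eq_mul_div, div_le_iff₀ (by positivity)]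
  by_cases hsmall : δ * (n : ℝ) ^ 2 < 1
  · have h1 : (1 : ℝ) ≤ lowDiamNumber n ε 2 := by
      apply one_le_lowDiamNumber hε (by norm_num)
      rw [Nat.cast_choose_two]
      have h2 : ε * (n : ℝ) ^ 2 ≤ (1 / 4 - δ) * (n : ℝ) ^ 2 := by gcongr
      have h3 : 0 < δ * (n : ℝ) ^ 2 := by positivity
      nlinarith
    have h2 : δ * (n : ℝ) ≤ 1 := by nlinarith
    nlinarith
  push Not at hsmall
  set α := Fin (n / 2)
  set β := Fin (n - n / 2)
  have hcardαβ : Fintype.card α + Fintype.card β = n := by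
    simp only [α, β, Fintype.card_fin]
    omega
  obtain ⟨R, hR, hrect⟩ := exists_dense_relation_without_large_rectangles α β hq
  rw [hcardαβ] at hrect
  have hmain := card_le_lowDiamNumber_of_bipartite R (s := 1) (n := n) (d := 2) (ε := ε)
    (K := q * (n + 2)) (by rw [hcardαβ, one_mul]) hε (by norm_num) (by
      intro R' hR' hd
      have h1 : (R'.image Prod.fst) ×ˢ (R'.image Prod.snd) ⊆ R := by
        rintro ⟨a, b⟩ hab
        obtain ⟨ha, hb⟩ := Finset.mem_product.1 hab
        obtain ⟨⟨_, b'⟩, hx, rfl⟩ := Finset.mem_image.1 ha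
        obtain ⟨⟨a', _⟩, hy, rfl⟩ := Finset.mem_image.1 hb
        exact hR' (hd.mem hx hy)
      have h2 := hrect _ _ h1
      rw [← Finset.card_product] at h2
      have h3 : R' ⊆ (R'.image Prod.fst) ×ˢ (R'.image Prod.snd) := Finset.subset_product
      exact_mod_cast (Finset.card_le_card h3).trans h2)
  simp only [Nat.cast_one, one_pow, one_mul] at hmain
  set N : ℝ := (Fintype.card α * Fintype.card β : ℝ) with hN
  have hsum : (Fintype.card α : ℝ) + Fintype.card β = n := by exact_mod_cast hcardαβ
  have hdiff : ((Fintype.card α : ℝ) - Fintype.card β) ^ 2 ≤ 1 := by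
    have h1 : Fintype.card β = Fintype.card α ∨ Fintype.card β = Fintype.card α + 1 := by
      simp only [α, β, Fintype.card_fin]
      omega
    rcases h1 with h1 | h1 <;> rw [h1] <;> push_cast <;> ring_nf <;> norm_num
  have hNlow : (n : ℝ) ^ 2 - 1 ≤ 4 * N := by
    rw [hN, ← hsum]
    linarith
  have hNup : 4 * N ≤ (n : ℝ) ^ 2 := by
    rw [hN, ← hsum]
    nlinarith [sq_nonneg ((Fintype.card α : ℝ) - Fintype.card β)]
  have hN0 : 0 ≤ N := by positivity
  have hRcard : N - δ * N ≤ R.card := by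
    have h1 : (q : ℝ) * N ≤ q * (R.card + δ * N) := by nlinarith
    have := le_of_mul_le_mul_left h1 hq0
    linarith
  set P : ℝ := (lowDiamNumber n ε 2 : ℝ)
  have hP0 : 0 ≤ P := Nat.cast_nonneg _
  have h2 : ε * (n : ℝ) ^ 2 ≤ (1 / 4 - δ) * (n : ℝ) ^ 2 := by gcongr
  -- At least `3 δ n ^ 2 / 4 - 1 / 4` edges are not exceptional, and `δ n ^ 2 ≥ 1` absorbs the
  -- parity loss `1 / 4`.
  have h3 : δ * (n : ℝ) ^ 2 / 2 ≤ P * (q * (n + 2)) := by nlinarith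
  have h4 : P * (q * (n + 2)) ≤ P * (q * (2 * n)) := by gcongr; linarith
  have h5 : (δ * n) * (n : ℝ) ≤ (P * (4 * q)) * n := by nlinarith
  exact le_of_mul_le_mul_right h5 (by linarith)

theorem theorem1 :
    -- (a)
    (∀ δ : ℝ, 0 < δ → ∃ c : ℝ, 0 < c ∧ ∀ (n : ℕ) (ε : ℝ), 2 ≤ n → 0 ≤ ε → ε ≤ 1 / 4 - δ →
      c * (n : ℝ) ≤ (lowDiamNumber n ε 2 : ℝ) ∧ (lowDiamNumber n ε 2 : ℝ) ≤ (n : ℝ)) ∧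
    -- (b)
    (∃ c : ℝ, 0 < c ∧ ∀ (n : ℕ) (ε : ℝ), 1 ≤ n → 1 / √(n : ℝ) ≤ ε →
      (lowDiamNumber n ε 3 : ℝ) ≤ 50 / ε ^ 2 ∧
      (ε * (n : ℝ) ^ 2 < (n.choose 2 : ℝ) → c / ε ^ 2 ≤ (lowDiamNumber n ε 3 : ℝ))) ∧
    -- (c)
    (∃ c : ℝ, 0 < c ∧ ∀ (n : ℕ) (ε : ℝ), 1 ≤ n → 1 / (n : ℝ) ≤ ε →
      (lowDiamNumber n ε 4 : ℝ) ≤ 16 / ε ∧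
      (ε * (n : ℝ) ^ 2 < (n.choose 2 : ℝ) → c / ε ≤ (lowDiamNumber n ε 4 : ℝ))) := by
  refine ⟨fun δ hδ => ?_, ⟨1 / 40960, by norm_num, fun n ε hn hε => ?_⟩,
    ⟨1 / 100, by norm_num, fun n ε hn hε => ?_⟩⟩
  · obtain ⟨c, hc, h⟩ := exists_const_mul_le_lowDiamNumber_two hδ
    exact ⟨c, hc, fun n ε hn hε hεδ =>
      ⟨h n ε hn hε hεδ, by exact_mod_cast lowDiamNumber_two_le n hε⟩⟩
  · have hn' : (0 : ℝ) < n := by exact_mod_cast hn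
    have hε0 : 0 < ε := lt_of_lt_of_le (one_div_pos.2 (Real.sqrt_pos.2 hn')) hε
    refine ⟨(lowDiamNumber_three_le hn hε0).trans ?_, le_lowDiamNumber_three hn hε⟩
    gcongr
    norm_num
  · have hn' : (0 : ℝ) < n := by exact_mod_cast hn
    have hε0 : 0 < ε := lt_of_lt_of_le (one_div_pos.2 hn') hε
    refine ⟨(lowDiamNumber_four_le hn hε0).trans ?_, le_lowDiamNumber_four hn hε⟩
    gcongr
    norm_num
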